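/- Setting. Let $d\in\{2,3\}$, let $\Omega\subset\mathbb R^d$ be a bounded open domain with convex polygonal boundary, partitioned into open sets $\Omega_1,\Omega_2$ and a smooth closed interface $\Omega_0=\partial\Omega_2\subset\Omega$ with unit normal $n_0$; put $d_0=d-1$, $d_1=d_2=d$. For $i=1,2$ let $\nabla_i=\nabla$, and let $\nabla_0=(I-n_0\otimes n_0)\nabla$, $\nabla_n=n_0\cdot\nabla$. Fix $i\in\{0,1,2\}$. Let $A_i$ be a matrix field on $\Omega_i$, smooth up to the boundary, with $\alpha_{0,i}|\xi|^2\le\alpha_i(x)|\xi|^2\le (A_i(x)\xi,\xi)$ for all $x\in\Omega_i$ and all $\xi$ tangent to $\Omega_i$ at $x$, where $\alpha_{0,i}>0$ (symmetry of $A_i$ is not needed). Write $(\cdot,\cdot)_\omega$ for $L^2$ products with respect to the Euclidean measure of the relevant dimension and $\|w\|^2_{A,\omega}=(Aw,w)_\omega$. Let $\mathcal T_h$ be a conforming partition of $\Omega$ into closed simplices that is quasiuniform and shape regular with constant $\sigma$ and mesh parameter $h\in(0,h_0]$. The active mesh $\mathcal T_{h,i}$ consists of the elements meeting $\Omega_i$,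 $\mathcal F_{h,i}$ is the set of its interior faces, $\mathcal K_{h,i}=\{T\cap\Omega_i: T\in\mathcal T_{h,i}\}$, $\mathcal E_{h,i}=\{F\cap\Omega_i:F\in\mathcal F_{h,i}\}$, and $W_{h,i}$ is the space of discontinuous piecewise linear functions on $\mathcal T_{h,i}$ that vanish on $\partial\Omega$. For $i=0$ assume that $|F\cap\Omega_0|_{d-2}\le c_E h^{d-2}$ for all $F\in\mathcal F_{h,0}$ (for $d=2$: the number of points of $F\cap\Omega_0$ is bounded). On a face shared by $T_1,T_2$ let $\nu_{i,j}$ be the exterior unit normal of $T_j$ if $i=1,2$, and the exterior unit co-normal of $T_j\cap\Omega_0$ if $i=0$ (set to $0$ at points where the face is tangent to $\Omega_0$); let $[v]=v_1-v_2$, $\langle \nabla_i v\rangle=\theta_{F,1}\nabla_i v_1+\theta_{F,2}\nabla_i v_2$ and $\langle\nu_i\cdot A_i\nabla_i v\rangle=\theta_{F,1}\nu_{i,1}\cdot A_i\nabla_i v_1-\theta_{F,2}\nu_{i,2}\cdot A_i\nabla_i v_2$, with arbitrary weights $\theta_{F,j}\ge0$, $\theta_{F,1}+\theta_{F,2}=1$.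 Let $\mathcal M_{h,i}$ be a partition of $\mathcal T_{h,i}$ into macro elements $M=\bigcup_{T\in\mathcal T_{h,i,M}}T$ such that each $\mathcal T_{h,i,M}$ contains an element $T_M$ with $|T_M\cap\Omega_i|\ge\gamma\, h_{T_M}^{d_i}$, where $h_T$ is the diameter of $T$ and $\gamma>0$, to which each of its elements is connected by a chain of face neighbours in $\mathcal T_{h,i,M}$ crossing at most $N$ faces. Let $\mathcal F_{h,i}(M)$ be the interior faces of $\mathcal T_{h,i,M}$ and put $c_{A_i,M}=\|A_i\|_{L^\infty(M)}/\inf_M\alpha_i$ (supremum and infimum over $M\cap\Omega_i$). Let $$s_{h,i,M}(v,w)=\sum_{k=0}^1\tau_{i,k}h^{2k-1}([\nabla^kv],[\nabla^kw])_{\mathcal F_{h,i}(M)}\quad(i=1,2),$$ $$s_{h,0,M}(v,w)=\sum_{k=0}^1\tau_{0,k}h^{2k-2}([\nabla^kv],[\nabla^kw])_{\mathcal F_{h,0}(M)}+\tau_{0,2}h^2(\nabla_nv,\nabla_nw)_{M\cap\Omega_0},$$ where $c_1\|A_i\|_{L^\infty(M)}\le\tau_{i,k}\le c_2\|A_i\|_{L^\infty(M)}$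 with $c_1>0$ (the $\tau_{i,k}$ may depend on $M$), $s_{h,i}=\sum_{M}s_{h,i,M}$, $\|v\|^2_{s_{h,i,M}}=s_{h,i,M}(v,v)$, $\|v\|^2_{s_{h,i}}=s_{h,i}(v,v)$. For a penalty parameter $\tau_{a_i}$ let $$a_{h,i}(v,w)=(A_i\nabla_iv,\nabla_iw)_{\mathcal K_{h,i}}-(\langle\nu_i\cdot A_i\nabla_iv\rangle,[w])_{\mathcal E_{h,i}}-([v],\langle\nu_i\cdot A_i\nabla_iw\rangle)_{\mathcal E_{h,i}}+(\tau_{a_i}(\nu_i\cdot A_i\nu_i)h^{-1}[v],[w])_{\mathcal E_{h,i}},$$ $$|||v|||_{h,i}^2=\|\nabla_iv\|^2_{A_i,\mathcal K_{h,i}}+h\|\langle\nabla_iv\rangle\|^2_{A_i,\mathcal E_{h,i}}+h^{-1}\|\nu_i[v]\|^2_{A_i,\mathcal E_{h,i}}+\|v\|^2_{s_{h,i}}.$$ Claim. Let the geometry, $i$, $h_0$, $\sigma$, $\gamma$, $N$, $c_1$, $c_2$ and (for $i=0$) $c_E$ be given. (1) There is a constant $C>0$, depending only on these data and not on $h$,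 the mesh and its position relative to $\Omega_0$, the macro element partition, $A_i$ or the $\tau_{i,k}$, such that for all $v\in W_{h,i}$ and all $M\in\mathcal M_{h,i}$ $$h\,\|\nabla_iv\|^2_{A_i,\mathcal E_{h,i}(\overline M)}\le C\big(c_{A_i,M}\|\nabla_iv\|^2_{A_i,M\cap\Omega_i}+\|v\|^2_{s_{h,i,M}}\big),$$ where $\mathcal E_{h,i}(\overline M)$ consists of the sets $F\cap\Omega_i$ for the faces $F\in\mathcal F_{h,i}$ with $F\subset M$, and on each face the traces of $\nabla_iv$ from all elements of $M$ having this face are counted; and consequently, counting the traces from both sides on every face, $$h\,\|\nabla_iv\|^2_{A_i,\mathcal E_{h,i}}\le C\sum_{M\in\mathcal M_{h,i}}\big(c_{A_i,M}\|\nabla_iv\|^2_{A_i,M\cap\Omega_i}+\|v\|^2_{s_{h,i,M}}\big).$$ (2) For every $c_A$ there are $\tau_0>0$ and $c>0$, depending only on these data and $c_A$, such that, whenever $\sup_{M\in\mathcal M_{h,i}}c_{A_i,M}\le c_A$ and $\tau_{a_i}\ge\tau_0$, $$c\,|||v|||^2_{h,i}\le a_{h,i}(v,v)+s_{h,i}(v,v)\qquad\text{for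 all }v\in W_{h,i}.$$ -/

import Mathlib

open Set MeasureTheory Topology
open scoped ContDiff RealInnerProductSpace

noncomputable section

namespace CutFEM

/-- The ambient Euclidean space `ℝᵈ`. -/
abbrev Space (d : ℕ) := EuclideanSpace ℝ (Fin d)

/-! ### Geometry -/

/-- A bounded open domain `Ω` with convex polygonal boundary, partitioned into `Ω₁`, `Ω₂` and a
smooth closed internal interface `Ω₀`, where `Ω₂` is the part inside `Ω₀`.
`dom 0`, `dom 1`, `dom 2` are `Ω₀`, `Ω₁`, `Ω₂`, and `normal` restricted to `Ω₀` is the unit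
normal of `Ω₀` exterior to `Ω₂`. -/
structure CutDomain (d : ℕ) where
  Omega : Set (Space d)
  dom : Fin 3 → Set (Space d)
  normal : Space d → Space d
  isOpen_Omega : IsOpen Omega
  convex_Omega : Convex ℝ Omega
  polygonal_Omega : ∃ V : Finset (Space d), closure Omega = convexHull ℝ (V : Set (Space d))
  isOpen_dom_two : IsOpen (dom 2)
  dom_two_subset : dom 2 ⊆ Omega
  dom_zero_eq : dom 0 = frontier (dom 2)
  dom_zero_subset : dom 0 ⊆ Omega
  dom_one_eq : dom 1 = Omega \ closure (dom 2)
  /-- Near each of its points, `Ω₀` is the regular zero level set of a smooth function that is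
  negative exactly in `Ω₂`, and the normal is the normalized gradient of that function. -/
  smooth_interface : ∀ x ∈ dom 0, ∃ φ : Space d → ℝ, ∃ U ∈ 𝓝 x, ContDiff ℝ ∞ φ ∧
    (∀ y ∈ U, (y ∈ dom 2 ↔ φ y < 0) ∧ (y ∈ dom 0 ↔ φ y = 0)) ∧
    ∀ y ∈ U ∩ dom 0, gradient φ y ≠ 0 ∧ normal y = ‖gradient φ y‖⁻¹ • gradient φ y

/-- The dimension `dᵢ` of `Ωᵢ`: `d₀ = d - 1` and `d₁ = d₂ = d`. -/
def domDim (d : ℕ) (i : Fin 3) : ℕ := if i = 0 then d - 1 else d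

/-- The codimension `d - dᵢ` of `Ωᵢ`. -/
def domCodim (i : Fin 3) : ℤ := if i = 0 then 1 else 0

/-- The projection of a vector to the tangent space of `Ωᵢ` at `x`: the identity for `i = 1, 2`
and `I - n₀ ⊗ n₀` for `i = 0`. -/
def tangentPart {d : ℕ} (G : CutDomain d) (i : Fin 3) (x ξ : Space d) : Space d :=
  if i = 0 then ξ - ⟪G.normal x, ξ⟫ • G.normal x else ξ

/-! ### Diffusion coefficients -/

/-- A smooth, uniformly positive definite matrix field `Aᵢ` on `Ωᵢ`, with pointwise coercivity
constant `αᵢ(x)` on the tangent space of `Ωᵢ` at `x`. Symmetry is not required. -/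
structure DiffusionField {d : ℕ} (G : CutDomain d) (i : Fin 3) where
  A : Space d → (Space d →L[ℝ] Space d)
  alpha : Space d → ℝ
  smooth : ContDiffOn ℝ ∞ A (closure (G.dom i))
  coercive : ∃ alpha0 : ℝ, 0 < alpha0 ∧ ∀ x ∈ G.dom i, alpha0 ≤ alpha x ∧
    ∀ ξ : Space d, tangentPart G i x ξ = ξ → alpha x * ‖ξ‖ ^ 2 ≤ ⟪A x ξ, ξ⟫

/-! ### Meshes -/

/-- The closed simplex with the given vertices (also used for faces of simplices). -/
def body {d : ℕ} (T : Finset (Space d)) : Set (Space d) := convexHull ℝ (T : Set (Space d))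

/-- A conforming quasiuniform partition of `Ω` into shape regular simplices, with mesh
parameter `h` and regularity constant `σ`. An element is given by its set of `d + 1` vertices. -/
structure Mesh {d : ℕ} (G : CutDomain d) (h σ : ℝ) where
  cells : Finset (Finset (Space d))
  card_eq : ∀ T ∈ cells, T.card = d + 1
  indep : ∀ T ∈ cells, AffineIndependent ℝ ((↑) : T → Space d)
  conforming : ∀ T ∈ cells, ∀ T' ∈ cells,
    body T ∩ body T' = convexHull ℝ ((T : Set (Space d)) ∩ (T' : Set (Space d)))
  cover : ⋃ T ∈ cells, body T = closure G.Omega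
  quasiuniform : ∀ T ∈ cells, h ≤ σ * Metric.diam (body T) ∧ Metric.diam (body T) ≤ σ * h
  shape_regular : ∀ T ∈ cells, ∃ x, Metric.ball x (Metric.diam (body T) / σ) ⊆ body T

open scoped Classical in
/-- The common face `T ∩ T'` of two elements, given by its vertices. -/
def face {d : ℕ} (T T' : Finset (Space d)) : Finset (Space d) := T ∩ T'

/-- Two distinct elements are face neighbours if they share a `(d-1)`-dimensional face. -/
def FaceNeighbor {d : ℕ} (T T' : Finset (Space d)) : Prop := T ≠ T' ∧ (face T T').card = d

open scoped Classical in
/-- The active mesh `𝒯_{h,i}`: the elements that meet `Ωᵢ`. -/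
def Mesh.active {d : ℕ} {G : CutDomain d} {h σ : ℝ} (mesh : Mesh G h σ) (i : Fin 3) :
    Finset (Finset (Space d)) :=
  mesh.cells.filter fun T => (body T ∩ G.dom i).Nonempty

/-- The space `W_{h,i}` of discontinuous piecewise linear functions on the active mesh that
vanish on `∂Ω`; `v T` is the affine function whose restriction to `T` is `v|_T`, and only its
values for active elements `T` matter. -/
def Mesh.feSpace {d : ℕ} {G : CutDomain d} {h σ : ℝ} (mesh : Mesh G h σ) (i : Fin 3) :
    Set (Finset (Space d) → (Space d →ᵃ[ℝ] ℝ)) :=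
  {v | ∀ T ∈ mesh.active i, ∀ F ⊆ T, F.card = d → body F ⊆ frontier G.Omega →
    ∀ x ∈ body F, v T x = 0}

/-- The traces `F ∩ Ω₀` of the interior faces `F` of `𝒯_{h,0}` on the interface have
`(d-2)`-dimensional measure at most `c h^{d-2}`. -/
def Mesh.SurfaceCutBound {d : ℕ} {G : CutDomain d} {h σ : ℝ} (mesh : Mesh G h σ) (c : ℝ) : Prop :=
  ∀ T ∈ mesh.active 0, ∀ T' ∈ mesh.active 0, FaceNeighbor T T' →
    μHE[d - 2] (body (face T T') ∩ G.dom 0) ≤ ENNReal.ofReal (c * h ^ (d - 2))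

/-! ### Macro elements -/

/-- The element `T` has a large intersection with `Ωᵢ`. -/
def LargeIntersection {d : ℕ} (G : CutDomain d) (i : Fin 3) (γ : ℝ) (T : Finset (Space d)) :
    Prop :=
  γ ≤ (μHE[domDim d i] : Measure (Space d)).real (body T ∩ G.dom i) /
    Metric.diam (body T) ^ domDim d i

/-- A macro element partition of the active mesh `𝒯_{h,i}`. A macro element is given by its set
of elements; it contains an element `T_M` with a large intersection to which each of its elements
is connected by a chain, inside the macro element, that crosses at most `N` faces. -/
structure MacroPartition {d : ℕ} {G : CutDomain d} {h σ : ℝ} (mesh : Mesh G h σ) (i : Fin 3)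
    (γ : ℝ) (N : ℕ) where
  macros : Finset (Finset (Finset (Space d)))
  subset_active : ∀ M ∈ macros, M ⊆ mesh.active i
  existsUnique : ∀ T ∈ mesh.active i, ∃! M, M ∈ macros ∧ T ∈ M
  connected : ∀ M ∈ macros, ∃ TM ∈ M, LargeIntersection G i γ TM ∧
    ∀ T ∈ M, ∃ n ≤ N, ∃ p : ℕ → Finset (Space d), p 0 = TM ∧ p n = T ∧
      (∀ k ≤ n, p k ∈ M) ∧ ∀ k < n, FaceNeighbor (p k) (p (k + 1))

/-- The part `M ∩ Ωᵢ` of a macro element. -/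
def macroCut {d : ℕ} (G : CutDomain d) (i : Fin 3) (M : Finset (Finset (Space d))) :
    Set (Space d) :=
  (⋃ T ∈ M, body T) ∩ G.dom i

/-- `‖Aᵢ‖_{L^∞(M)}`, with the Euclidean operator norm; the field lives on `M ∩ Ωᵢ`. -/
def supNorm {d : ℕ} {G : CutDomain d} {i : Fin 3} (D : DiffusionField G i)
    (M : Finset (Finset (Space d))) : ℝ :=
  sSup ((fun x => ‖D.A x‖) '' macroCut G i M)

/-- The contrast `c_{A_i,M} = ‖Aᵢ‖_{L^∞(M)} / inf_M αᵢ`. -/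
def contrast {d : ℕ} {G : CutDomain d} {i : Fin 3} (D : DiffusionField G i)
    (M : Finset (Finset (Space d))) : ℝ :=
  supNorm D M / sInf (D.alpha '' macroCut G i M)

/-! ### Gradients, normals, jumps and averages -/

/-- The (constant) gradient in `ℝᵈ` of an affine function. -/
def grad {d : ℕ} (p : Space d →ᵃ[ℝ] ℝ) : Space d :=
  (InnerProductSpace.toDual ℝ (Space d)).symm (LinearMap.toContinuousLinearMap p.linear)

/-- The gradient `∇ᵢ` at `x` of an affine function: full for `i = 1, 2`, tangential for `i = 0`. -/
def gradAt {d : ℕ} (G : CutDomain d) (i : Fin 3) (p : Space d →ᵃ[ℝ] ℝ) (x : Space d) : Space d :=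
  tangentPart G i x (grad p)

/-- The barycentre of a finite set of points. -/
def barycentre {d : ℕ} (T : Finset (Space d)) : Space d := (T.card : ℝ)⁻¹ • ∑ x ∈ T, x

/-- The exterior unit normal of a simplex `T` on its `(d-1)`-dimensional face `F`: the normalized
component orthogonal to `F` of the vector from the barycentre of `T` to that of `F`. -/
def faceNormal {d : ℕ} (T F : Finset (Space d)) : Space d :=
  let w := (vectorSpan ℝ (F : Set (Space d)))ᗮ.starProjection (barycentre F - barycentre T)
  ‖w‖⁻¹ • w

/-- The vector `ν_{i,T}` at the point `x` of the face of `T` shared with `T'`. For `i = 1, 2` it is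
the exterior unit normal of `T`; for `i = 0` it is the exterior unit co-normal of `T ∩ Ω₀`, the
normalized tangential part of the normal. (It is `0` where the face is tangent to `Ω₀`, where no
co-normal exists.) -/
def conormal {d : ℕ} (G : CutDomain d) (i : Fin 3) (T T' : Finset (Space d)) (x : Space d) :
    Space d :=
  let w := tangentPart G i x (faceNormal T (face T T'))
  ‖w‖⁻¹ • w

/-- The jump `[v]` on the face shared by `T` and `T'`, enumerated in this order. -/
def jump {d : ℕ} (v : Finset (Space d) → (Space d →ᵃ[ℝ] ℝ)) (T T' : Finset (Space d))
    (x : Space d) : ℝ :=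
  v T x - v T' x

/-- Weights of the averages: `θ T T'` is the weight of `T` on the face shared with `T'`. -/
def IsWeight {d : ℕ} (θ : Finset (Space d) → Finset (Space d) → ℝ) : Prop :=
  ∀ T T', FaceNeighbor T T' → 0 ≤ θ T T' ∧ θ T T' + θ T' T = 1

/-- The average `⟨∇ᵢ v⟩` on the face shared by `T` and `T'`. -/
def avgGrad {d : ℕ} (G : CutDomain d) (i : Fin 3) (θ : Finset (Space d) → Finset (Space d) → ℝ)
    (v : Finset (Space d) → (Space d →ᵃ[ℝ] ℝ)) (T T' : Finset (Space d)) (x : Space d) : Space d :=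
  θ T T' • gradAt G i (v T) x + θ T' T • gradAt G i (v T') x

/-- The average `⟨νᵢ · Aᵢ ∇ᵢ v⟩ = θ₁ ν_{i,1} · Aᵢ ∇ᵢ v₁ - θ₂ ν_{i,2} · Aᵢ ∇ᵢ v₂` on the face shared by
`T` and `T'`, enumerated in this order. -/
def avgFlux {d : ℕ} {G : CutDomain d} {i : Fin 3} (D : DiffusionField G i)
    (θ : Finset (Space d) → Finset (Space d) → ℝ)
    (v : Finset (Space d) → (Space d →ᵃ[ℝ] ℝ)) (T T' : Finset (Space d)) (x : Space d) : ℝ :=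
  θ T T' * ⟪conormal G i T T' x, D.A x (gradAt G i (v T) x)⟫ -
    θ T' T * ⟪conormal G i T' T x, D.A x (gradAt G i (v T') x)⟫

/-! ### Integrals -/

/-- The integral over `T ∩ Ωᵢ` with respect to the `dᵢ`-dimensional measure. -/
def cellInt {d : ℕ} (G : CutDomain d) (i : Fin 3) (T : Finset (Space d)) (f : Space d → ℝ) : ℝ :=
  ∫ x in body T ∩ G.dom i, f x ∂(μHE[domDim d i] : Measure (Space d))

/-- The integral over `F ∩ Ωᵢ` with respect to the `(dᵢ-1)`-dimensional measure. -/
def cutFaceInt {d : ℕ} (G : CutDomain d) (i : Fin 3) (F : Finset (Space d)) (f : Space d → ℝ) :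
    ℝ :=
  ∫ x in body F ∩ G.dom i, f x ∂(μHE[domDim d i - 1] : Measure (Space d))

/-- The integral over a full face `F` with respect to the `(d-1)`-dimensional measure. -/
def fullFaceInt {d : ℕ} (F : Finset (Space d)) (f : Space d → ℝ) : ℝ :=
  ∫ x in body F, f x ∂(μHE[d - 1] : Measure (Space d))

open scoped Classical in
/-- The sum of `f` over the interior faces of a set `S` of elements. Every such face is met in both
enumerations `(T, T')` and `(T', T)` of its two elements, hence the factor `1/2`; the functions
summed below do not depend on the enumeration. -/
def faceSum {d : ℕ} (S : Finset (Finset (Space d)))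
    (f : Finset (Space d) → Finset (Space d) → ℝ) : ℝ :=
  (1 / 2) * ∑ T ∈ S, ∑ T' ∈ S with FaceNeighbor T T', f T T'

/-! ### Forms and norms -/

/-- The macro element stabilization form `s_{h,i,M}(v, w)`, with parameters `τ k = τ_{i,k}`. -/
def stabMacro {d : ℕ} (G : CutDomain d) (i : Fin 3) (h : ℝ) (τ : Fin 3 → ℝ)
    (M : Finset (Finset (Space d))) (v w : Finset (Space d) → (Space d →ᵃ[ℝ] ℝ)) : ℝ :=
  τ 0 * h ^ (-1 - domCodim i) *
      faceSum M (fun T T' => fullFaceInt (face T T') fun x => jump v T T' x * jump w T T' x) +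
    τ 1 * h ^ (1 - domCodim i) *
      faceSum M (fun T T' => fullFaceInt (face T T') fun _ =>
        ⟪grad (v T) - grad (v T'), grad (w T) - grad (w T')⟫) +
    (if i = 0 then
      τ 2 * h ^ 2 * ∑ T ∈ M, cellInt G 0 T fun x =>
        ⟪G.normal x, grad (v T)⟫ * ⟪G.normal x, grad (w T)⟫
    else 0)

/-- The stabilization form `s_{h,i}(v, w)`; the parameters `τ M k` may depend on the macro
element. -/
def stab {d : ℕ} {G : CutDomain d} {i : Fin 3} {h σ γ : ℝ} {N : ℕ} {mesh : Mesh G h σ}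
    (P : MacroPartition mesh i γ N) (τ : Finset (Finset (Space d)) → Fin 3 → ℝ)
    (v w : Finset (Space d) → (Space d →ᵃ[ℝ] ℝ)) : ℝ :=
  ∑ M ∈ P.macros, stabMacro G i h (τ M) M v w

/-- The stabilization parameters satisfy `τ_{i,k} ∼ ‖Aᵢ‖_{L^∞(M)}`, with constants `c₁`, `c₂`. -/
def IsStabParam {d : ℕ} {G : CutDomain d} {i : Fin 3} {h σ γ : ℝ} {N : ℕ} {mesh : Mesh G h σ}
    (P : MacroPartition mesh i γ N) (D : DiffusionField G i) (c₁ c₂ : ℝ)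
    (τ : Finset (Finset (Space d)) → Fin 3 → ℝ) : Prop :=
  ∀ M ∈ P.macros, ∀ k, c₁ * supNorm D M ≤ τ M k ∧ τ M k ≤ c₂ * supNorm D M

/-- `(Aᵢ ∇ᵢ v, ∇ᵢ w)` over the intersections with `Ωᵢ` of the elements in `S`. -/
def gradForm {d : ℕ} {G : CutDomain d} {i : Fin 3} (D : DiffusionField G i)
    (S : Finset (Finset (Space d))) (v w : Finset (Space d) → (Space d →ᵃ[ℝ] ℝ)) : ℝ :=
  ∑ T ∈ S, cellInt G i T fun x => ⟪D.A x (gradAt G i (v T) x), gradAt G i (w T) x⟫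

open scoped Classical in
/-- `‖∇ᵢ v‖²_{A_i}` over the intersections with `Ωᵢ` of the faces in `𝓕_{h,i}` of the elements in
`S`, where on each face the traces from all elements of `S` that have this face are taken. For `S`
the elements of a macro element `M` the faces are those of `𝓕_{h,i}` contained in `M`, and for `S`
the active mesh they are all faces of `𝓕_{h,i}`. -/
def gradFaceNormSq {d : ℕ} {G : CutDomain d} {i : Fin 3} {h σ : ℝ} (mesh : Mesh G h σ)
    (D : DiffusionField G i) (S : Finset (Finset (Space d)))
    (v : Finset (Space d) → (Space d →ᵃ[ℝ] ℝ)) : ℝ :=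
  ∑ T ∈ S, ∑ T' ∈ mesh.active i with FaceNeighbor T T',
    cutFaceInt G i (face T T') fun x => ⟪D.A x (gradAt G i (v T) x), gradAt G i (v T) x⟫

/-- The form `a_{h,i}(v, w)` with penalty parameter `τa`. -/
def dgForm {d : ℕ} {G : CutDomain d} {i : Fin 3} {h σ : ℝ} (mesh : Mesh G h σ)
    (D : DiffusionField G i) (θ : Finset (Space d) → Finset (Space d) → ℝ) (τa : ℝ)
    (v w : Finset (Space d) → (Space d →ᵃ[ℝ] ℝ)) : ℝ :=
  gradForm D (mesh.active i) v w -
    faceSum (mesh.active i) (fun T T' => cutFaceInt G i (face T T') fun x =>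
      avgFlux D θ v T T' x * jump w T T' x) -
    faceSum (mesh.active i) (fun T T' => cutFaceInt G i (face T T') fun x =>
      jump v T T' x * avgFlux D θ w T T' x) +
    faceSum (mesh.active i) (fun T T' => cutFaceInt G i (face T T') fun x =>
      τa * ⟪conormal G i T T' x, D.A x (conormal G i T T' x)⟫ * h⁻¹ *
        jump v T T' x * jump w T T' x)

/-- The square of the norm `|||v|||_{h,i}`. -/
def dgNormSq {d : ℕ} {G : CutDomain d} {i : Fin 3} {h σ γ : ℝ} {N : ℕ} {mesh : Mesh G h σ}
    (P : MacroPartition mesh i γ N) (D : DiffusionField G i)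
    (τ : Finset (Finset (Space d)) → Fin 3 → ℝ) (θ : Finset (Space d) → Finset (Space d) → ℝ)
    (v : Finset (Space d) → (Space d →ᵃ[ℝ] ℝ)) : ℝ :=
  gradForm D (mesh.active i) v v +
    h * faceSum (mesh.active i) (fun T T' => cutFaceInt G i (face T T') fun x =>
      ⟪D.A x (avgGrad G i θ v T T' x), avgGrad G i θ v T T' x⟫) +
    h⁻¹ * faceSum (mesh.active i) (fun T T' => cutFaceInt G i (face T T') fun x =>
      ⟪D.A x (jump v T T' x • conormal G i T T' x), jump v T T' x • conormal G i T T' x⟫) +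
    stab P τ v v

end CutFEM

end

open CutFEM

/-!
The trace inequality is local to a macro element `M` with its large element `T_M`. Gradients are
constant on elements, so on a face the trace of `∇ᵢ v` is the tangential part, at the points of the
face, of the full gradient of an element `T` of `M`. That gradient differs from the gradient of
`T_M` by at most `N` jumps across faces of `M` (`Mesh.chain_estimate`). A full face of a shape
regular simplex has measure of order `h ^ (d - 1)` because it contains a ball of its hyperplane
whose radius is of order `h` (`exists_ball_subset_face`); hence the gradient jumps are controlled by
the stabilization.

It remains to bound the tangential part, at the points of the face, of the gradient of `T_M`. Since
`|T_M ∩ Ωᵢ|` is of order `h ^ dᵢ`, a bound by the gradient at every point of `T_M ∩ Ωᵢ` can be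
integrated over that set. On the interface the tangential projection varies with the base point, but
the normal is Lipschitz continuous on the compact smooth interface. Moving the base point by a
distance of order `h` therefore changes the square of the tangential part only by `h²` times the
square of the full gradient, whose normal part is what the term with weight `h²` in the
stabilization controls (`exists_tangentPart_sq_le`, `supNorm_mul_tangentPart_sq_le`). Comparing
`‖Aᵢ‖` with the lower bound of the coefficient produces the contrast. Cut faces have measure at most
of order `h ^ (dᵢ - 1)`, and macro elements have boundedly many elements and faces by a volume
argument, which gives `exists_macro_face_bound`. Summation over the macro elements gives the global
inequality.

Coercivity (`coercivity_of_face_bound`) is then the usual argument for symmetric interior penalty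
methods. The coefficient need not be symmetric: the flux is bounded by `‖Aᵢ‖` times the norms of the
two vectors, and each of them is compared with its energy by means of the contrast. Young's
inequality and the trace inequality absorb the consistency terms in half of the energy and of the
stabilization, and in the penalty term once its parameter is large.
-/

namespace CutFEM

/-! ### Volumes of simplices and of their faces -/

section Volumes

variable {d : ℕ}

/-- The volume of the unit ball of `ℝᵏ`. -/
noncomputable def unitBallVolume (k : ℕ) : ℝ :=
  (volume : Measure (Space k)).real (Metric.ball 0 1)

theorem unitBallVolume_pos (k : ℕ) : 0 < unitBallVolume k :=
  ENNReal.toReal_pos (Metric.measure_ball_pos _ _ one_pos).ne' measure_ball_lt_top.ne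

theorem isCompact_body (T : Finset (Space d)) : IsCompact (body T) :=
  T.finite_toSet.isCompact_convexHull ℝ

theorem body_mono {F T : Finset (Space d)} (h : F ⊆ T) : body F ⊆ body T :=
  convexHull_mono (by exact_mod_cast h)

theorem dist_le_diam_body (T : Finset (Space d)) {x y : Space d} (hx : x ∈ body T)
    (hy : y ∈ body T) : dist x y ≤ Metric.diam (body T) :=
  Metric.dist_le_diam_of_mem (isCompact_body T).isBounded hx hy

theorem exists_linearIsometry_range_eq (E : Submodule ℝ (Space d)) {k : ℕ}
    (hk : Module.finrank ℝ E = k) :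
    ∃ L : Space k →ₗᵢ[ℝ] Space d, Set.range L = (E : Set (Space d)) := by
  subst hk
  refine ⟨E.subtypeₗᵢ.comp (stdOrthonormalBasis ℝ E).repr.symm.toLinearIsometry, ?_⟩
  ext x
  constructor
  · rintro ⟨u, rfl⟩
    exact ((stdOrthonormalBasis ℝ E).repr.symm u).2
  · intro hx
    exact ⟨(stdOrthonormalBasis ℝ E).repr ⟨x, hx⟩, by simp⟩

theorem muHE_isometry_image_ball {k : ℕ} {f : Space k → Space d} (hf : Isometry f) {r : ℝ}
    (hr : 0 < r) :
    (μHE[k] : Measure (Space d)) (f '' Metric.ball 0 r) =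
      ENNReal.ofReal (r ^ k * unitBallVolume k) := by
  rw [hf.euclideanHausdorffMeasure_image, EuclideanSpace.euclideanHausdorffMeasure_eq_volume,
    Measure.addHaar_ball_of_pos _ _ hr, ENNReal.ofReal_mul (by positivity), unitBallVolume,
    ofReal_measureReal measure_ball_lt_top.ne, finrank_euclideanSpace_fin]

theorem isometry_add_linearIsometry {k : ℕ} (p : Space d) (L : Space k →ₗᵢ[ℝ] Space d) :
    Isometry fun u => p + L u :=
  (isometry_add_left p).comp L.isometry

/-- A simplex of dimension `k` and diameter less than `r` lies in a ball of radius `r` of its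
affine span. -/
theorem muHE_body_le {F : Finset (Space d)} {k : ℕ}
    (hk : Module.finrank ℝ (vectorSpan ℝ (F : Set (Space d))) = k) {r : ℝ} (hr : 0 < r)
    (hF : ∀ x ∈ body F, ∀ y ∈ body F, dist x y < r) :
    (μHE[k] : Measure (Space d)) (body F) ≤ ENNReal.ofReal (r ^ k * unitBallVolume k) := by
  rcases (body F).eq_empty_or_nonempty with h | ⟨p, hp⟩
  · simp [h]
  obtain ⟨L, hL⟩ := exists_linearIsometry_range_eq _ hk
  rw [← muHE_isometry_image_ball (isometry_add_linearIsometry p L) hr]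
  refine measure_mono fun x hx => ?_
  have hmem : x - p ∈ vectorSpan ℝ (F : Set (Space d)) := by
    rw [← direction_affineSpan]
    exact AffineSubspace.vsub_mem_direction (convexHull_subset_affineSpan _ hx)
      (convexHull_subset_affineSpan _ hp)
  rw [← SetLike.mem_coe, ← hL] at hmem
  obtain ⟨u, hu⟩ := hmem
  refine ⟨u, ?_, by simp [hu]⟩
  rw [mem_ball_zero_iff, ← L.norm_map, hu, ← dist_eq_norm]
  exact hF x hx p hp

theorem le_muHE_body {F : Finset (Space d)} {k : ℕ}
    (hk : Module.finrank ℝ (vectorSpan ℝ (F : Set (Space d))) = k) {r : ℝ} (hr : 0 < r)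
    {p : Space d} (hp : ∀ u ∈ vectorSpan ℝ (F : Set (Space d)), ‖u‖ < r → p + u ∈ body F) :
    ENNReal.ofReal (r ^ k * unitBallVolume k) ≤ (μHE[k] : Measure (Space d)) (body F) := by
  obtain ⟨L, hL⟩ := exists_linearIsometry_range_eq _ hk
  rw [← muHE_isometry_image_ball (isometry_add_linearIsometry p L) hr]
  refine measure_mono ?_
  rintro _ ⟨u, hu, rfl⟩
  refine hp _ ?_ (by simpa using hu)
  rw [← SetLike.mem_coe, ← hL]
  exact mem_range_self u

/-- If a simplex contains a ball of radius `r`, then each of its faces contains a ball of radius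
`r` of the hyperplane of the face. -/
theorem exists_ball_subset_face {T F : Finset (Space d)} (hT : T.card = d + 1)
    (hind : AffineIndependent ℝ ((↑) : T → Space d)) (hFT : F ⊆ T) (hF : F.card = d)
    (hF0 : F.Nonempty) {x : Space d} {r : ℝ} (hx : Metric.ball x r ⊆ body T) :
    ∃ p, ∀ u ∈ vectorSpan ℝ (F : Set (Space d)), ‖u‖ < r → p + u ∈ body F := by
  classical
  have htop : affineSpan ℝ (Set.range ((↑) : T → Space d)) = ⊤ := by
    rw [hind.affineSpan_eq_top_iff_card_eq_finrank_add_one]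
    simp [hT]
  let b : AffineBasis T ℝ (Space d) := ⟨(↑), hind, htop⟩
  have hb : ∀ i : T, b i = (i : Space d) := fun i => rfl
  have hbody : body T = {x | ∀ i, 0 ≤ b.coord i x} := by
    rw [← b.convexHull_eq_nonneg_coord, body]
    congr 1
    ext y
    simp [hb]
  obtain ⟨a, haT, haF⟩ : ∃ a ∈ T, a ∉ F := by
    by_contra! h
    have := Finset.card_le_card (show T ⊆ F from h)
    omega
  have hTF : ∀ i ∈ T, i ≠ a → i ∈ F := by
    intro i hi hia
    by_contra hiF
    have h1 : insert a (insert i F) ⊆ T := by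
      intro z hz
      simp only [Finset.mem_insert] at hz
      rcases hz with rfl | rfl | hz
      exacts [haT, hi, hFT hz]
    have h2 := Finset.card_le_card h1
    rw [Finset.card_insert_of_notMem (by simp [haF, hia.symm]), Finset.card_insert_of_notMem hiF]
      at h2
    omega
  obtain ⟨f, hf⟩ := hF0
  let ia : T := ⟨a, haT⟩
  -- moving the barycentric weight of the opposite vertex `a` to the vertex `f` maps `T` to `F`
  have key : ∀ y ∈ body T, y + b.coord ia y • (f - a) ∈ body F := by
    intro y hy
    rw [hbody] at hy
    have hy1 := b.linear_combination_coord_eq_self y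
    have hy2 := b.sum_coord_apply_eq_one y
    have e : y + b.coord ia y • (f - a) =
        ∑ i : T, (if i = ia then b.coord ia y • f else b.coord i y • (i : Space d)) := by
      rw [Finset.sum_ite, Finset.filter_eq' _ ia]
      simp only [Finset.mem_univ, if_true, Finset.sum_singleton]
      have h3 := Finset.sum_erase_add Finset.univ (fun i => b.coord i y • b i) (Finset.mem_univ ia)
      rw [hy1] at h3
      rw [Finset.filter_ne']
      nth_rewrite 1 [← h3]
      simp only [hb, smul_sub]
      have : (ia : Space d) = a := rfl
      rw [this]
      abel
    rw [e]
    have e2 : ∀ i : T, (if i = ia then b.coord ia y • f else b.coord i y • (i : Space d)) =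
        b.coord i y • (if i = ia then f else (i : Space d)) := by
      intro i
      split_ifs with h
      · rw [h]
      · rfl
    simp only [e2]
    refine (convex_convexHull ℝ _).sum_mem (fun i _ => hy i) hy2 fun i _ => ?_
    refine subset_convexHull ℝ _ ?_
    split_ifs with h
    · exact hf
    · exact hTF i i.2 fun h' => h (Subtype.ext h')
  have hlin : ∀ u ∈ vectorSpan ℝ (F : Set (Space d)), (b.coord ia).linear u = 0 := by
    intro u hu
    rw [vectorSpan_def] at hu
    induction hu using Submodule.span_induction with
    | mem z hz =>
      obtain ⟨p, hp, q, hq, rfl⟩ := hz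
      have hz : ∀ p ∈ F, b.coord ia p = 0 := fun p hp => by
        have := b.coord_apply ia ⟨p, hFT hp⟩
        rw [hb] at this
        rw [this, if_neg]
        rintro h
        exact haF (by rw [show a = p from congrArg Subtype.val h]; exact hp)
      rw [AffineMap.linearMap_vsub, hz p hp, hz q hq, vsub_self]
    | zero => simp
    | add p q _ _ hp hq => rw [map_add, hp, hq, add_zero]
    | smul c p _ hp => rw [map_smul, hp, smul_zero]
  refine ⟨x + b.coord ia x • (f - a), fun u hu hur => ?_⟩
  have h1 := key (x + u) (hx (by simpa using hur))
  have h2 : b.coord ia (x + u) = b.coord ia x := by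
    have := (b.coord ia).map_vadd x u
    rw [hlin u hu, zero_vadd, vadd_eq_add, add_comm] at this
    exact this
  rw [h2] at h1
  convert h1 using 1
  abel

theorem volume_convexHull_eq_zero {S : Finset (Space d)} (hS : S.card ≤ d) :
    volume (convexHull ℝ (S : Set (Space d))) = 0 := by
  classical
  rcases S.eq_empty_or_nonempty with rfl | hne
  · simp
  refine measure_mono_null (convexHull_subset_affineSpan _)
    (Measure.addHaar_affineSubspace _ _ fun htop => ?_)
  have h1 : Module.finrank ℝ (vectorSpan ℝ (S : Set (Space d))) ≤ S.card - 1 := by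
    have := finrank_vectorSpan_image_finset_le ℝ (id : Space d → Space d) S
      (n := S.card - 1) (by have := hne.card_pos; omega)
    rwa [Finset.image_id] at this
  rw [← direction_affineSpan, htop, AffineSubspace.direction_top, finrank_top,
    finrank_euclideanSpace_fin] at h1
  have := hne.card_pos
  omega

end Volumes

/-! ### Shape regular meshes -/

section Meshes

variable {d : ℕ} {G : CutDomain d} {h σ : ℝ}

theorem Mesh.sigma_pos (mesh : Mesh G h σ) (hh : 0 < h) {T : Finset (Space d)}
    (hT : T ∈ mesh.cells) : 0 < σ := by
  have h1 := (mesh.quasiuniform T hT).1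
  have h2 : 0 ≤ Metric.diam (body T) := Metric.diam_nonneg
  by_contra! hσ
  nlinarith

theorem Mesh.le_diam (mesh : Mesh G h σ) (hh : 0 < h) {T : Finset (Space d)}
    (hT : T ∈ mesh.cells) : h / σ ≤ Metric.diam (body T) := by
  rw [div_le_iff₀' (mesh.sigma_pos hh hT)]
  exact (mesh.quasiuniform T hT).1

theorem Mesh.exists_ball (mesh : Mesh G h σ) (hh : 0 < h) {T : Finset (Space d)}
    (hT : T ∈ mesh.cells) : ∃ x, Metric.ball x (h / σ ^ 2) ⊆ body T := by
  obtain ⟨x, hx⟩ := mesh.shape_regular T hT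
  refine ⟨x, (Metric.ball_subset_ball ?_).trans hx⟩
  have hσ := mesh.sigma_pos hh hT
  rw [pow_two, ← div_div]
  gcongr
  exact mesh.le_diam hh hT

theorem face_comm (T T' : Finset (Space d)) : face T T' = face T' T := by
  simp only [face, Finset.inter_comm]

theorem face_subset_left (T T' : Finset (Space d)) : face T T' ⊆ T := by
  simp only [face, Finset.inter_subset_left]

theorem face_subset_right (T T' : Finset (Space d)) : face T T' ⊆ T' := by
  simp only [face, Finset.inter_subset_right]

theorem FaceNeighbor.symm {T T' : Finset (Space d)} (hn : FaceNeighbor T T') :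
    FaceNeighbor T' T :=
  ⟨hn.1.symm, by rw [face_comm]; exact hn.2⟩

theorem Mesh.finrank_face (mesh : Mesh G h σ) (hd : 0 < d) {T T' : Finset (Space d)}
    (hT : T ∈ mesh.cells) (hn : FaceNeighbor T T') :
    Module.finrank ℝ (vectorSpan ℝ (face T T' : Set (Space d))) = d - 1 := by
  have h1 : AffineIndependent ℝ ((↑) : face T T' → Space d) :=
    (mesh.indep T hT).mono (by exact_mod_cast face_subset_left T T')
  have h2 := h1.finrank_vectorSpan (n := d - 1) (by
    rw [Fintype.card_coe, hn.2]; omega)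
  rwa [show range ((↑) : face T T' → Space d) = (face T T' : Set (Space d)) from
    Subtype.range_coe] at h2

theorem Mesh.muHE_face_le (mesh : Mesh G h σ) (hd : 0 < d) (hh : 0 < h) {T T' : Finset (Space d)}
    (hT : T ∈ mesh.cells) (hn : FaceNeighbor T T') :
    (μHE[d - 1] : Measure (Space d)) (body (face T T')) ≤
      ENNReal.ofReal ((2 * σ * h) ^ (d - 1) * unitBallVolume (d - 1)) := by
  have hσ := mesh.sigma_pos hh hT
  refine muHE_body_le (mesh.finrank_face hd hT hn) (by positivity) fun x hx y hy => ?_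
  have h1 := dist_le_diam_body T (body_mono (face_subset_left T T') hx)
    (body_mono (face_subset_left T T') hy)
  have h2 := (mesh.quasiuniform T hT).2
  have h3 : 0 < σ * h := by positivity
  linarith

theorem Mesh.le_muHE_face (mesh : Mesh G h σ) (hd : 0 < d) (hh : 0 < h) {T T' : Finset (Space d)}
    (hT : T ∈ mesh.cells) (hn : FaceNeighbor T T') :
    (h / σ ^ 2) ^ (d - 1) * unitBallVolume (d - 1) ≤
      (μHE[d - 1] : Measure (Space d)).real (body (face T T')) := by
  have hσ := mesh.sigma_pos hh hT
  obtain ⟨x, hx⟩ := mesh.exists_ball hh hT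
  have hr : 0 < h / σ ^ 2 := by positivity
  obtain ⟨p, hp⟩ := exists_ball_subset_face (mesh.card_eq T hT) (mesh.indep T hT)
    (face_subset_left T T') hn.2 (Finset.card_pos.1 (by rw [hn.2]; exact hd)) hx
  refine (ENNReal.ofReal_le_iff_le_toReal ?_).1 (le_muHE_body (mesh.finrank_face hd hT hn) hr hp)
  exact ((mesh.muHE_face_le hd hh hT hn).trans_lt ENNReal.ofReal_lt_top).ne

theorem Mesh.aedisjoint_body (mesh : Mesh G h σ) {T T' : Finset (Space d)} (hT : T ∈ mesh.cells)
    (hT' : T' ∈ mesh.cells) (hne : T ≠ T') : AEDisjoint volume (body T) (body T') := by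
  classical
  rw [AEDisjoint, mesh.conforming T hT T' hT', ← Finset.coe_inter]
  refine volume_convexHull_eq_zero ?_
  by_contra! hlt
  have h1 := mesh.card_eq T hT
  have h2 := mesh.card_eq T' hT'
  have e1 := Finset.eq_of_subset_of_card_le (Finset.inter_subset_left (s₁ := T) (s₂ := T'))
    (by omega)
  have e2 := Finset.eq_of_subset_of_card_le (Finset.inter_subset_right (s₁ := T) (s₂ := T'))
    (by omega)
  exact hne (e1.symm.trans e2)

/-- A ball of radius comparable to `h` contains a bounded number of elements, since the elements
overlap in null sets only and each contains a ball of radius comparable to `h`. -/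
theorem Mesh.card_le_of_subset_closedBall (mesh : Mesh G h σ) (hh : 0 < h)
    {S : Finset (Finset (Space d))} (hS : S ⊆ mesh.cells) {x : Space d} {R : ℝ} (hR : 0 ≤ R)
    (hSx : ∀ T ∈ S, body T ⊆ Metric.closedBall x (R * h)) :
    (S.card : ℝ) ≤ (R * σ ^ 2) ^ d := by
  rcases S.eq_empty_or_nonempty with rfl | ⟨T₀, hT₀⟩
  · simp only [Finset.card_empty, CharP.cast_eq_zero]; positivity
  have hσ := mesh.sigma_pos hh (hS hT₀)
  have hr : 0 < h / σ ^ 2 := by positivity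
  have hB := unitBallVolume_pos d
  have h1 : volume.real (⋃ T ∈ S, body T) = ∑ T ∈ S, volume.real (body T) :=
    measureReal_biUnion_finset₀
      (fun T hT T' hT' hne => mesh.aedisjoint_body (hS hT) (hS hT') hne)
      (fun T _ => (isCompact_body T).measurableSet.nullMeasurableSet)
      (fun T _ => (isCompact_body T).measure_ne_top)
  have h2 : volume.real (⋃ T ∈ S, body T) ≤ (R * h) ^ d * unitBallVolume d := by
    refine (measureReal_mono (iUnion₂_subset hSx) measure_closedBall_lt_top.ne).trans_eq ?_
    rw [Measure.addHaar_real_closedBall _ _ (by positivity), finrank_euclideanSpace_fin]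
    rfl
  have h3 : ∀ T ∈ S, (h / σ ^ 2) ^ d * unitBallVolume d ≤ volume.real (body T) := by
    intro T hT
    obtain ⟨y, hy⟩ := mesh.exists_ball hh (hS hT)
    refine le_trans (le_of_eq ?_) (measureReal_mono hy (isCompact_body T).measure_ne_top)
    rw [measureReal_def, Measure.addHaar_ball_of_pos _ _ hr, ENNReal.toReal_mul,
      ENNReal.toReal_ofReal (by positivity), finrank_euclideanSpace_fin]
    rfl
  have h4 := (Finset.card_nsmul_le_sum S _ _ h3).trans (h1.ge.trans h2)
  rw [nsmul_eq_mul, ← mul_assoc] at h4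
  have h5 := le_of_mul_le_mul_right h4 hB
  rw [div_pow, mul_pow, mul_div_assoc', div_le_iff₀ (by positivity)] at h5
  have h6 : (S.card : ℝ) * h ^ d ≤ (R * σ ^ 2) ^ d * h ^ d := by
    rw [mul_pow]
    linarith
  exact le_of_mul_le_mul_right h6 (by positivity)

end Meshes

/-! ### The interface normal and tangential gradients -/

section Geometry

variable {d : ℕ} {G : CutDomain d} {i : Fin 3}

theorem CutDomain.measurableSet_dom (G : CutDomain d) (i : Fin 3) : MeasurableSet (G.dom i) := by
  fin_cases i
  · exact G.dom_zero_eq ▸ isClosed_frontier.measurableSet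
  · exact G.dom_one_eq ▸ (G.isOpen_Omega.measurableSet.diff isClosed_closure.measurableSet)
  · exact G.isOpen_dom_two.measurableSet

theorem CutDomain.dom_subset (G : CutDomain d) (i : Fin 3) : G.dom i ⊆ G.Omega := by
  fin_cases i
  · exact G.dom_zero_subset
  · exact G.dom_one_eq ▸ sdiff_subset
  · exact G.dom_two_subset

theorem CutDomain.isCompact_closure_Omega (G : CutDomain d) : IsCompact (closure G.Omega) := by
  obtain ⟨V, hV⟩ := G.polygonal_Omega
  exact hV ▸ V.finite_toSet.isCompact_convexHull ℝ

theorem CutDomain.isCompact_closure_dom (G : CutDomain d) (i : Fin 3) :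
    IsCompact (closure (G.dom i)) :=
  G.isCompact_closure_Omega.of_isClosed_subset isClosed_closure (closure_mono (G.dom_subset i))

theorem CutDomain.isCompact_dom_zero (G : CutDomain d) : IsCompact (G.dom 0) := by
  have h := G.isCompact_closure_dom 0
  rwa [(G.dom_zero_eq ▸ isClosed_frontier : IsClosed (G.dom 0)).closure_eq] at h

theorem CutDomain.norm_normal (G : CutDomain d) {x : Space d} (hx : x ∈ G.dom 0) :
    ‖G.normal x‖ = 1 := by
  obtain ⟨φ, U, hU, -, -, hn⟩ := G.smooth_interface x hx
  obtain ⟨h0, h1⟩ := hn x ⟨mem_of_mem_nhds hU, hx⟩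
  rw [h1, norm_smul, norm_inv, norm_norm, inv_mul_cancel₀ (norm_ne_zero_iff.2 h0)]

/-- The normal of the compact smooth interface is Lipschitz continuous with respect to the
Euclidean distance: near each point it is the restriction of a smooth map. -/
theorem CutDomain.exists_lipschitzOnWith_normal (G : CutDomain d) :
    ∃ K, LipschitzOnWith K G.normal (G.dom 0) := by
  refine LocallyLipschitzOn.exists_lipschitzOnWith_of_compact G.isCompact_dom_zero ?_
  intro x hx
  obtain ⟨φ, U, hU, hφ, -, hn⟩ := G.smooth_interface x hx
  have h0 := (hn x ⟨mem_of_mem_nhds hU, hx⟩).1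
  have hg : ContDiff ℝ 1 (gradient φ) :=
    (InnerProductSpace.toDual ℝ (Space d)).symm.contDiff.comp
      (hφ.fderiv_right (m := 1) (by norm_cast))
  have hs : ContDiffAt ℝ 1 (fun y => ‖gradient φ y‖⁻¹ • gradient φ y) x :=
    ((hg.contDiffAt.norm ℝ h0).inv (norm_ne_zero_iff.2 h0)).smul hg.contDiffAt
  obtain ⟨K, t, ht, hK⟩ := hs.exists_lipschitzOnWith
  refine ⟨K, t ∩ U ∩ G.dom 0,
    Filter.inter_mem (mem_nhdsWithin_of_mem_nhds (Filter.inter_mem ht hU)) self_mem_nhdsWithin, ?_⟩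
  intro y hy z hz
  rw [(hn y ⟨hy.1.2, hy.2⟩).2, (hn z ⟨hz.1.2, hz.2⟩).2]
  exact hK hy.1.1 hz.1.1

theorem tangentPart_add (G : CutDomain d) (i : Fin 3) (x ξ η : Space d) :
    tangentPart G i x (ξ + η) = tangentPart G i x ξ + tangentPart G i x η := by
  unfold tangentPart
  split_ifs
  · rw [inner_add_right, add_smul]; abel
  · rfl

theorem tangentPart_smul (G : CutDomain d) (i : Fin 3) (x : Space d) (c : ℝ) (ξ : Space d) :
    tangentPart G i x (c • ξ) = c • tangentPart G i x ξ := by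
  unfold tangentPart
  split_ifs
  · rw [inner_smul_right, smul_sub, smul_smul]
  · rfl

theorem tangentPart_tangentPart {x : Space d} (hx : x ∈ G.dom i) (ξ : Space d) :
    tangentPart G i x (tangentPart G i x ξ) = tangentPart G i x ξ := by
  unfold tangentPart
  split_ifs with hi
  · subst hi
    rw [inner_sub_right, inner_smul_right, real_inner_self_eq_norm_sq, G.norm_normal hx]
    simp
  · rfl

/-- The square of the component of `ξ` normal to `Ωᵢ` at `x`, which is `0` for the domains of
full dimension. -/
noncomputable def normalSq (G : CutDomain d) (i : Fin 3) (x ξ : Space d) : ℝ :=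
  if i = 0 then ⟪G.normal x, ξ⟫ ^ 2 else 0

theorem normalSq_nonneg (G : CutDomain d) (i : Fin 3) (x ξ : Space d) : 0 ≤ normalSq G i x ξ := by
  unfold normalSq
  split_ifs <;> positivity

theorem norm_sq_eq_tangentPart_add_normalSq {x : Space d} (hx : x ∈ G.dom i) (ξ : Space d) :
    ‖ξ‖ ^ 2 = ‖tangentPart G i x ξ‖ ^ 2 + normalSq G i x ξ := by
  unfold tangentPart normalSq
  split_ifs with hi
  · subst hi
    rw [norm_sub_sq_real, norm_smul, G.norm_normal hx, inner_smul_right, real_inner_comm,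
      Real.norm_eq_abs, mul_one, sq_abs]
    ring
  · simp

theorem norm_tangentPart_le {x : Space d} (hx : x ∈ G.dom i) (ξ : Space d) :
    ‖tangentPart G i x ξ‖ ≤ ‖ξ‖ := by
  have h1 := norm_sq_eq_tangentPart_add_normalSq hx ξ
  have h2 := normalSq_nonneg G i x ξ
  exact le_of_sq_le_sq (by linarith) (norm_nonneg _)

theorem normalSq_le {x : Space d} (hx : x ∈ G.dom i) (ξ : Space d) :
    normalSq G i x ξ ≤ ‖ξ‖ ^ 2 := by
  have h1 := norm_sq_eq_tangentPart_add_normalSq hx ξ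
  nlinarith [norm_nonneg (tangentPart G i x ξ)]

/-- Tangential projections at two points of `Ωᵢ` differ by at most a multiple of the distance of
the points. -/
theorem exists_norm_tangentPart_sub_le (G : CutDomain d) (i : Fin 3) :
    ∃ K : ℝ, 0 ≤ K ∧ ∀ x ∈ G.dom i, ∀ y ∈ G.dom i, ∀ ξ,
      ‖tangentPart G i x ξ - tangentPart G i y ξ‖ ≤ K * dist x y * ‖ξ‖ := by
  by_cases hi : i = 0
  swap
  · exact ⟨0, le_rfl, fun x _ y _ ξ => by simp [tangentPart, hi]⟩
  subst hi
  obtain ⟨K, hK⟩ := G.exists_lipschitzOnWith_normal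
  refine ⟨2 * K, by positivity, fun x hx y hy ξ => ?_⟩
  have h1 : ‖G.normal y - G.normal x‖ ≤ K * dist x y := by
    rw [← dist_eq_norm, dist_comm]
    exact hK.dist_le_mul x hx y hy
  have h2 : tangentPart G 0 x ξ - tangentPart G 0 y ξ =
      ⟪G.normal y - G.normal x, ξ⟫ • G.normal y +
        ⟪G.normal x, ξ⟫ • (G.normal y - G.normal x) := by
    simp only [tangentPart, if_true, inner_sub_left, sub_smul, smul_sub]
    abel
  have h3 : ‖⟪G.normal y - G.normal x, ξ⟫ • G.normal y‖ ≤ K * dist x y * ‖ξ‖ := by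
    rw [norm_smul, G.norm_normal hy, mul_one]
    exact (norm_inner_le_norm _ _).trans (by gcongr)
  have h4 : ‖⟪G.normal x, ξ⟫ • (G.normal y - G.normal x)‖ ≤ K * dist x y * ‖ξ‖ := by
    rw [norm_smul, mul_comm]
    have := norm_inner_le_norm (𝕜 := ℝ) (G.normal x) ξ
    rw [G.norm_normal hx, one_mul] at this
    gcongr
  rw [h2]
  linarith [norm_add_le (⟪G.normal y - G.normal x, ξ⟫ • G.normal y)
    (⟪G.normal x, ξ⟫ • (G.normal y - G.normal x))]

theorem norm_add_sq_le_two {E : Type*} [SeminormedAddCommGroup E] (x y : E) :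
    ‖x + y‖ ^ 2 ≤ 2 * ‖x‖ ^ 2 + 2 * ‖y‖ ^ 2 := by
  nlinarith [norm_add_le x y, norm_nonneg (x + y), sq_nonneg (‖x‖ - ‖y‖)]

/-- Moving the base point of a tangential gradient by `O(h)` costs only `h²` times the square of
the normal component. This is why the normal gradient may be stabilized with the weak weight
`h²`. -/
theorem exists_tangentPart_sq_le (G : CutDomain d) (i : Fin 3) (R h₀ : ℝ) :
    ∃ K : ℝ, 0 < K ∧ ∀ h ∈ Ioc 0 h₀, ∀ x ∈ G.dom i, ∀ y ∈ G.dom i, dist x y ≤ R * h → ∀ ξ,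
      ‖tangentPart G i x ξ‖ ^ 2 ≤
        K * (‖tangentPart G i y ξ‖ ^ 2 + h ^ 2 * normalSq G i y ξ) := by
  obtain ⟨K, hK, H⟩ := exists_norm_tangentPart_sub_le G i
  refine ⟨2 + 2 * (K * R) ^ 2 * (1 + h₀ ^ 2), by positivity,
    fun h hh x hx y hy hxy ξ => ?_⟩
  have h1 : ‖tangentPart G i x ξ - tangentPart G i y ξ‖ ≤ K * R * h * ‖ξ‖ := by
    refine (H x hx y hy ξ).trans ?_
    rw [mul_assoc K R h]
    gcongr
  have h2 := norm_add_sq_le_two (tangentPart G i x ξ - tangentPart G i y ξ) (tangentPart G i y ξ)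
  rw [sub_add_cancel] at h2
  have h3 : ‖tangentPart G i x ξ - tangentPart G i y ξ‖ ^ 2 ≤ (K * R * h * ‖ξ‖) ^ 2 := by
    gcongr
  rw [mul_pow, norm_sq_eq_tangentPart_add_normalSq hy ξ] at h3
  have hn := normalSq_nonneg G i y ξ
  have hhh : h ^ 2 ≤ h₀ ^ 2 := by
    have := hh.1.le
    have := hh.2
    gcongr
  set a := ‖tangentPart G i y ξ‖ ^ 2 with ha
  have ha0 : 0 ≤ a := by positivity
  set n := normalSq G i y ξ
  calc ‖tangentPart G i x ξ‖ ^ 2 ≤ 2 * ((K * R * h) ^ 2 * (a + n)) + 2 * a := by linarith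
    _ = (2 + 2 * (K * R) ^ 2 * h ^ 2) * a + 2 * (K * R) ^ 2 * (h ^ 2 * n) := by ring
    _ ≤ (2 + 2 * (K * R) ^ 2 * (1 + h₀ ^ 2)) * a +
        (2 + 2 * (K * R) ^ 2 * (1 + h₀ ^ 2)) * (h ^ 2 * n) := by
      gcongr
      · linarith
      · have : 0 ≤ (K * R) ^ 2 * h₀ ^ 2 := by positivity
        linarith
    _ = _ := by ring

theorem continuousOn_tangentPart (G : CutDomain d) (i : Fin 3) (ξ : Space d) :
    ContinuousOn (fun x => tangentPart G i x ξ) (G.dom i) := by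
  unfold tangentPart
  split_ifs with hi
  · subst hi
    obtain ⟨K, hK⟩ := G.exists_lipschitzOnWith_normal
    have hc := hK.continuousOn
    fun_prop
  · exact continuousOn_const

theorem continuousOn_normalSq (G : CutDomain d) (i : Fin 3) (ξ : Space d) :
    ContinuousOn (fun x => normalSq G i x ξ) (G.dom i) := by
  unfold normalSq
  split_ifs with hi
  · subst hi
    obtain ⟨K, hK⟩ := G.exists_lipschitzOnWith_normal
    exact (hK.continuousOn.inner continuousOn_const).pow 2
  · exact continuousOn_const

theorem tangentPart_conormal {x : Space d} (hx : x ∈ G.dom i) (T T' : Finset (Space d)) :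
    tangentPart G i x (conormal G i T T' x) = conormal G i T T' x := by
  simp only [conormal]
  rw [tangentPart_smul, tangentPart_tangentPart hx]

theorem norm_conormal_le (G : CutDomain d) (i : Fin 3) (T T' : Finset (Space d)) (x : Space d) :
    ‖conormal G i T T' x‖ ≤ 1 := by
  simp only [conormal, norm_smul, norm_inv, norm_norm]
  exact inv_mul_le_one

theorem aestronglyMeasurable_conormal (G : CutDomain d) (i : Fin 3) (T T' : Finset (Space d))
    {s : Set (Space d)} (hs : MeasurableSet s) (hsi : s ⊆ G.dom i) (μ : Measure (Space d)) :
    AEStronglyMeasurable (conormal G i T T') (μ.restrict s) := by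
  have h := ((continuousOn_tangentPart G i (faceNormal T (face T T'))).mono
    hsi).aestronglyMeasurable (μ := μ) hs
  exact h.norm.aemeasurable.inv.aestronglyMeasurable.smul h

end Geometry

/-! ### The diffusion field on a macro element -/

section Diffusion

variable {d : ℕ} {G : CutDomain d} {i : Fin 3} (D : DiffusionField G i)

theorem DiffusionField.exists_norm_le : ∃ B, ∀ x ∈ G.dom i, ‖D.A x‖ ≤ B := by
  obtain ⟨B, hB⟩ := (G.isCompact_closure_dom i).exists_bound_of_continuousOn D.smooth.continuousOn
  exact ⟨B, fun x hx => hB x (subset_closure hx)⟩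

theorem DiffusionField.inner_nonneg {x : Space d} (hx : x ∈ G.dom i) {ξ : Space d}
    (hξ : tangentPart G i x ξ = ξ) : 0 ≤ ⟪D.A x ξ, ξ⟫ := by
  obtain ⟨a, ha, H⟩ := D.coercive
  obtain ⟨h1, h2⟩ := H x hx
  exact le_trans (mul_nonneg (ha.le.trans h1) (sq_nonneg _)) (h2 ξ hξ)

theorem supNorm_nonneg (M : Finset (Finset (Space d))) : 0 ≤ supNorm D M :=
  Real.sSup_nonneg (by rintro _ ⟨x, -, rfl⟩; exact norm_nonneg _)

theorem norm_le_supNorm {M : Finset (Finset (Space d))} {x : Space d} (hx : x ∈ macroCut G i M) :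
    ‖D.A x‖ ≤ supNorm D M := by
  obtain ⟨B, hB⟩ := D.exists_norm_le
  refine le_csSup ⟨B, ?_⟩ ⟨x, hx, rfl⟩
  rintro _ ⟨y, hy, rfl⟩
  exact hB y hy.2

theorem sInf_alpha_pos {M : Finset (Finset (Space d))} (hM : (macroCut G i M).Nonempty) :
    0 < sInf (D.alpha '' macroCut G i M) := by
  obtain ⟨a, ha, H⟩ := D.coercive
  refine ha.trans_le (le_csInf (hM.image _) ?_)
  rintro _ ⟨y, hy, rfl⟩
  exact (H y hy.2).1

theorem sInf_alpha_mul_norm_sq_le {M : Finset (Finset (Space d))} {x : Space d}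
    (hx : x ∈ macroCut G i M) {ξ : Space d} (hξ : tangentPart G i x ξ = ξ) :
    sInf (D.alpha '' macroCut G i M) * ‖ξ‖ ^ 2 ≤ ⟪D.A x ξ, ξ⟫ := by
  obtain ⟨a, ha, H⟩ := D.coercive
  refine le_trans ?_ ((H x hx.2).2 ξ hξ)
  gcongr
  refine csInf_le ⟨a, ?_⟩ ⟨x, hx, rfl⟩
  rintro _ ⟨y, hy, rfl⟩
  exact (H y hy.2).1

theorem contrast_nonneg {M : Finset (Finset (Space d))} (hM : (macroCut G i M).Nonempty) :
    0 ≤ contrast D M :=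
  div_nonneg (supNorm_nonneg D M) (sInf_alpha_pos D hM).le

theorem supNorm_mul_norm_sq_le {M : Finset (Finset (Space d))} {x : Space d}
    (hx : x ∈ macroCut G i M) {ξ : Space d} (hξ : tangentPart G i x ξ = ξ) :
    supNorm D M * ‖ξ‖ ^ 2 ≤ contrast D M * ⟪D.A x ξ, ξ⟫ := by
  have ha := sInf_alpha_pos D ⟨x, hx⟩
  have h1 := sInf_alpha_mul_norm_sq_le D hx hξ
  rw [contrast, div_mul_eq_mul_div, le_div_iff₀ ha]
  calc supNorm D M * ‖ξ‖ ^ 2 * sInf (D.alpha '' macroCut G i M)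
      = supNorm D M * (sInf (D.alpha '' macroCut G i M) * ‖ξ‖ ^ 2) := by ring
    _ ≤ _ := mul_le_mul_of_nonneg_left h1 (supNorm_nonneg D M)

theorem inner_le_norm_mul_sq {E : Type*} [NormedAddCommGroup E] [InnerProductSpace ℝ E]
    (A : E →L[ℝ] E) (ξ η : E) : |⟪ξ, A η⟫| ≤ ‖A‖ * (‖ξ‖ * ‖η‖) := by
  refine (abs_real_inner_le_norm _ _).trans ?_
  have := A.le_opNorm η
  calc ‖ξ‖ * ‖A η‖ ≤ ‖ξ‖ * (‖A‖ * ‖η‖) := by gcongr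
    _ = _ := by ring

theorem inner_le_supNorm_mul {M : Finset (Finset (Space d))} {x : Space d}
    (hx : x ∈ macroCut G i M) (ξ : Space d) : ⟪D.A x ξ, ξ⟫ ≤ supNorm D M * ‖ξ‖ ^ 2 := by
  have h1 := inner_le_norm_mul_sq (D.A x) ξ ξ
  rw [real_inner_comm] at h1
  refine (le_abs_self _).trans (h1.trans ?_)
  rw [← pow_two]
  gcongr
  exact norm_le_supNorm D hx

theorem integrableOn_inner_diffusion {s : Set (Space d)} (hs : MeasurableSet s)
    (hsi : s ⊆ G.dom i) {μ : Measure (Space d)} (hμ : μ s ≠ ⊤) {w : Space d → Space d}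
    (hw : AEStronglyMeasurable w (μ.restrict s)) {R : ℝ} (hR : ∀ x ∈ s, ‖w x‖ ≤ R) :
    IntegrableOn (fun x => ⟪D.A x (w x), w x⟫) s μ := by
  obtain ⟨B, hB⟩ := D.exists_norm_le
  have hA : AEStronglyMeasurable D.A (μ.restrict s) :=
    (D.smooth.continuousOn.mono (hsi.trans subset_closure)).aestronglyMeasurable hs
  have hAw : AEStronglyMeasurable (fun x => D.A x (w x)) (μ.restrict s) :=
    (isBoundedBilinearMap_apply (𝕜 := ℝ) (E := Space d)
      (F := Space d)).continuous.comp_aestronglyMeasurable (hA.prodMk hw)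
  have hfin : IsFiniteMeasure (μ.restrict s) := ⟨by simpa using hμ.lt_top⟩
  refine Integrable.of_bound (hAw.inner hw) (B * (R * R)) ?_
  filter_upwards [ae_restrict_mem hs] with x hx
  rw [Real.norm_eq_abs, real_inner_comm]
  have h1 := hR x hx
  have h2 := hB x (hsi hx)
  have h3 := (norm_nonneg _).trans h2
  have h4 := (norm_nonneg _).trans h1
  refine (inner_le_norm_mul_sq _ _ _).trans ?_
  gcongr

theorem integrableOn_inner_gradAt {s : Set (Space d)} (hs : MeasurableSet s)
    (hsi : s ⊆ G.dom i) {μ : Measure (Space d)} (hμ : μ s ≠ ⊤) (p : Space d →ᵃ[ℝ] ℝ) :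
    IntegrableOn (fun x => ⟪D.A x (gradAt G i p x), gradAt G i p x⟫) s μ :=
  integrableOn_inner_diffusion D hs hsi hμ
    (((continuousOn_tangentPart G i (grad p)).mono hsi).aestronglyMeasurable hs)
    (R := ‖grad p‖) fun _ hx => norm_tangentPart_le (hsi hx) _

theorem tangentPart_gradAt {x : Space d} (hx : x ∈ G.dom i) (p : Space d →ᵃ[ℝ] ℝ) :
    tangentPart G i x (gradAt G i p x) = gradAt G i p x :=
  tangentPart_tangentPart hx _

theorem cellInt_inner_gradAt_nonneg (T : Finset (Space d)) (p : Space d →ᵃ[ℝ] ℝ) :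
    0 ≤ cellInt G i T fun x => ⟪D.A x (gradAt G i p x), gradAt G i p x⟫ :=
  setIntegral_nonneg ((isCompact_body T).measurableSet.inter (G.measurableSet_dom i))
    fun _ hx => D.inner_nonneg hx.2 (tangentPart_gradAt hx.2 p)

end Diffusion

/-! ### Control of gradients on a macro element -/

section FaceSums

variable {d : ℕ}

theorem faceSum_nonneg {S : Finset (Finset (Space d))}
    {f : Finset (Space d) → Finset (Space d) → ℝ} (hf : ∀ T T', 0 ≤ f T T') : 0 ≤ faceSum S f :=
  mul_nonneg (by norm_num) (Finset.sum_nonneg fun _ _ => Finset.sum_nonneg fun _ _ => hf _ _)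

theorem le_two_mul_faceSum {S : Finset (Finset (Space d))}
    {f : Finset (Space d) → Finset (Space d) → ℝ} (hf : ∀ T T', 0 ≤ f T T')
    {T T' : Finset (Space d)} (hT : T ∈ S) (hT' : T' ∈ S) (hn : FaceNeighbor T T') :
    f T T' ≤ 2 * faceSum S f := by
  classical
  have h1 : f T T' ≤ ∑ T' ∈ S with FaceNeighbor T T', f T T' :=
    Finset.single_le_sum (f := fun T' => f T T') (fun _ _ => hf _ _) (Finset.mem_filter.2 ⟨hT', hn⟩)
  have h2 : ∑ T' ∈ S with FaceNeighbor T T', f T T' ≤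
      ∑ T ∈ S, ∑ T' ∈ S with FaceNeighbor T T', f T T' :=
    Finset.single_le_sum (f := fun T => ∑ T' ∈ S with FaceNeighbor T T', f T T')
      (fun _ _ => Finset.sum_nonneg fun _ _ => hf _ _) hT
  rw [faceSum]
  linarith

end FaceSums

section Macro

variable {d : ℕ} {G : CutDomain d} {i : Fin 3} {h σ : ℝ}

theorem Mesh.active_subset (mesh : Mesh G h σ) (i : Fin 3) : mesh.active i ⊆ mesh.cells := by
  classical
  exact Finset.filter_subset _ _

theorem body_inter_subset_macroCut {M : Finset (Finset (Space d))} {T : Finset (Space d)}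
    (hT : T ∈ M) : body T ∩ G.dom i ⊆ macroCut G i M :=
  fun _ hx => ⟨mem_biUnion hT hx.1, hx.2⟩

theorem macroCut_nonempty {mesh : Mesh G h σ} {M : Finset (Finset (Space d))}
    {T : Finset (Space d)} (hT : T ∈ M) (hTa : T ∈ mesh.active i) :
    (macroCut G i M).Nonempty := by
  classical
  exact (Finset.mem_filter.1 hTa).2.mono (body_inter_subset_macroCut hT)

theorem measurableSet_body_inter_dom (T : Finset (Space d)) :
    MeasurableSet (body T ∩ G.dom i) :=
  (isCompact_body T).measurableSet.inter (G.measurableSet_dom i)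

theorem pow_domDim (hd : 0 < d) :
    h ^ domDim d i = h ^ (1 - domCodim i) * h ^ (d - 1) := by
  by_cases hi : i = 0
  · simp [domDim, domCodim, hi]
  · simp only [domDim, domCodim, hi, if_false, sub_zero, zpow_one]
    rw [← pow_succ']
    congr 1
    omega

/-- Walking along a chain of face neighbours: distances grow by one element diameter and
gradients change by one jump with every face that is crossed. -/
theorem Mesh.chain_estimate (mesh : Mesh G h σ) (hd : 0 < d)
    {M : Finset (Finset (Space d))} (hM : M ⊆ mesh.cells)
    {v : Finset (Space d) → (Space d →ᵃ[ℝ] ℝ)} {β : ℝ}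
    (hβ : ∀ T ∈ M, ∀ T' ∈ M, FaceNeighbor T T' → ‖grad (v T) - grad (v T')‖ ≤ β)
    {p : ℕ → Finset (Space d)} {n : ℕ} (hpM : ∀ k ≤ n, p k ∈ M)
    (hp : ∀ k < n, FaceNeighbor (p k) (p (k + 1))) :
    ∀ k ≤ n, (∀ x ∈ body (p k), ∀ y ∈ body (p 0), dist x y ≤ (k + 1) * (σ * h)) ∧
      ‖grad (v (p k)) - grad (v (p 0))‖ ≤ k * β := by
  have hdiam : ∀ k ≤ n, ∀ x ∈ body (p k), ∀ y ∈ body (p k), dist x y ≤ σ * h :=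
    fun k hk x hx y hy => (dist_le_diam_body _ hx hy).trans
      (mesh.quasiuniform _ (hM (hpM k hk))).2
  intro k
  induction k with
  | zero =>
    intro hk
    refine ⟨fun x hx y hy => ?_, by simp⟩
    simpa using hdiam 0 hk x hx y hy
  | succ k ih =>
    intro hk
    obtain ⟨ih1, ih2⟩ := ih (by omega)
    have hn := hp k (by omega)
    constructor
    · intro x hx y hy
      obtain ⟨z, hz⟩ : (face (p k) (p (k + 1))).Nonempty :=
        Finset.card_pos.1 (by rw [hn.2]; exact hd)
      have hz1 : z ∈ body (p k) := subset_convexHull ℝ _ (face_subset_left _ _ hz)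
      have hz2 : z ∈ body (p (k + 1)) := subset_convexHull ℝ _ (face_subset_right _ _ hz)
      have h1 := hdiam (k + 1) hk x hx z hz2
      have h2 := ih1 z hz1 y hy
      push_cast
      linarith [dist_triangle x z y]
    · have h1 := hβ _ (hpM (k + 1) hk) _ (hpM k (by omega)) hn.symm
      have h2 := norm_sub_le_norm_sub_add_norm_sub (grad (v (p (k + 1)))) (grad (v (p k)))
        (grad (v (p 0)))
      push_cast
      linarith

/-- The sum over the interior faces of a macro element of the squared `L²` norms of the gradient
jumps. -/
noncomputable def jumpEnergy (M : Finset (Finset (Space d)))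
    (v : Finset (Space d) → (Space d →ᵃ[ℝ] ℝ)) : ℝ :=
  faceSum M fun T T' => fullFaceInt (face T T') fun _ =>
    ⟪grad (v T) - grad (v T'), grad (v T) - grad (v T')⟫

/-- The squared `L²` norm of the normal gradient over `M ∩ Ωᵢ`, which is `0` for `i = 1, 2`. -/
noncomputable def normalEnergy (G : CutDomain d) (i : Fin 3) (M : Finset (Finset (Space d)))
    (v : Finset (Space d) → (Space d →ᵃ[ℝ] ℝ)) : ℝ :=
  ∑ T ∈ M, cellInt G i T fun x => normalSq G i x (grad (v T))

theorem fullFaceInt_nonneg (F : Finset (Space d)) {f : Space d → ℝ} (hf : ∀ x, 0 ≤ f x) :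
    0 ≤ fullFaceInt F f :=
  integral_nonneg hf

theorem jumpEnergy_nonneg (M : Finset (Finset (Space d)))
    (v : Finset (Space d) → (Space d →ᵃ[ℝ] ℝ)) : 0 ≤ jumpEnergy M v :=
  faceSum_nonneg fun _ _ => fullFaceInt_nonneg _ fun _ => real_inner_self_nonneg

theorem cellInt_nonneg {T : Finset (Space d)} {f : Space d → ℝ} (hf : ∀ x ∈ G.dom i, 0 ≤ f x) :
    0 ≤ cellInt G i T f :=
  setIntegral_nonneg (measurableSet_body_inter_dom T) fun x hx => hf x hx.2

theorem normalEnergy_nonneg (M : Finset (Finset (Space d)))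
    (v : Finset (Space d) → (Space d →ᵃ[ℝ] ℝ)) : 0 ≤ normalEnergy G i M v :=
  Finset.sum_nonneg fun _ _ => cellInt_nonneg fun _ _ => normalSq_nonneg _ _ _ _

/-- The part of the stabilization form that the argument uses: the gradient jumps and, on the
interface, the normal gradient. -/
theorem le_stabMacro (hh : 0 < h) {s : ℝ} (hs : 0 ≤ s) {τ : Fin 3 → ℝ} (hτ : ∀ k, s ≤ τ k)
    (M : Finset (Finset (Space d))) (v : Finset (Space d) → (Space d →ᵃ[ℝ] ℝ)) :
    s * h ^ (1 - domCodim i) * jumpEnergy M v + s * h ^ 2 * normalEnergy G i M v ≤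
      stabMacro G i h τ M v v := by
  have h1 : 0 ≤ τ 0 * h ^ (-1 - domCodim i) * faceSum M (fun T T' =>
      fullFaceInt (face T T') fun x => jump v T T' x * jump v T T' x) :=
    mul_nonneg (mul_nonneg (hs.trans (hτ 0)) (by positivity))
      (faceSum_nonneg fun _ _ => fullFaceInt_nonneg _ fun _ => mul_self_nonneg _)
  have h2 : s * h ^ (1 - domCodim i) * jumpEnergy M v ≤
      τ 1 * h ^ (1 - domCodim i) * jumpEnergy M v := by
    have := jumpEnergy_nonneg M v
    have := hτ 1
    gcongr
  have h3 : s * h ^ 2 * normalEnergy G i M v ≤ if i = 0 then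
      τ 2 * h ^ 2 * ∑ T ∈ M, cellInt G 0 T fun x =>
        ⟪G.normal x, grad (v T)⟫ * ⟪G.normal x, grad (v T)⟫
      else 0 := by
    split_ifs with hi
    · subst hi
      have h4 : normalEnergy G 0 M v = ∑ T ∈ M, cellInt G 0 T fun x =>
          ⟪G.normal x, grad (v T)⟫ * ⟪G.normal x, grad (v T)⟫ := by
        simp only [normalEnergy, normalSq, if_true, pow_two]
      rw [← h4]
      have := normalEnergy_nonneg (G := G) (i := 0) M v
      have := hτ 2
      gcongr
    · simp [normalEnergy, normalSq, hi, cellInt]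
  rw [stabMacro]
  rw [jumpEnergy] at h2 ⊢
  linarith

theorem Mesh.grad_jump_sq_le (mesh : Mesh G h σ) (hd : 0 < d) (hh : 0 < h)
    {M : Finset (Finset (Space d))} (hM : M ⊆ mesh.cells)
    (v : Finset (Space d) → (Space d →ᵃ[ℝ] ℝ)) {T T' : Finset (Space d)} (hT : T ∈ M)
    (hT' : T' ∈ M) (hn : FaceNeighbor T T') :
    (h / σ ^ 2) ^ (d - 1) * unitBallVolume (d - 1) * ‖grad (v T) - grad (v T')‖ ^ 2 ≤
      2 * jumpEnergy M v := by
  have h1 := le_two_mul_faceSum (S := M) (f := fun T T' => fullFaceInt (face T T') fun _ =>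
    ⟪grad (v T) - grad (v T'), grad (v T) - grad (v T')⟫)
    (fun _ _ => fullFaceInt_nonneg _ fun _ => real_inner_self_nonneg) hT hT' hn
  refine le_trans ?_ h1
  simp only [fullFaceInt, setIntegral_const, smul_eq_mul, real_inner_self_eq_norm_sq]
  gcongr
  exact mesh.le_muHE_face hd hh (hM hT) hn

theorem gradForm_self_nonneg (D : DiffusionField G i) (S : Finset (Finset (Space d)))
    (v : Finset (Space d) → (Space d →ᵃ[ℝ] ℝ)) : 0 ≤ gradForm D S v v :=
  Finset.sum_nonneg fun _ _ => cellInt_inner_gradAt_nonneg D _ _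

/-- On an element with a large intersection, the tangential gradient at any point of `Ωᵢ` near the
element is controlled by its energy on the cut element, up to the normal gradient with the weight
`h²`. -/
theorem supNorm_mul_tangentPart_sq_le {mesh : Mesh G h σ} (hh : 0 < h) {γ : ℝ} (hγ : 0 < γ)
    (D : DiffusionField G i) {M : Finset (Finset (Space d))} {T : Finset (Space d)} (hTM : T ∈ M)
    (hT : T ∈ mesh.cells) (hL : LargeIntersection G i γ T) {K : ℝ} (hK : 0 ≤ K) {x : Space d}
    (p : Space d →ᵃ[ℝ] ℝ)
    (H : ∀ y ∈ body T ∩ G.dom i, ‖tangentPart G i x (grad p)‖ ^ 2 ≤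
      K * (‖tangentPart G i y (grad p)‖ ^ 2 + h ^ 2 * normalSq G i y (grad p))) :
    h ^ domDim d i * (supNorm D M * ‖tangentPart G i x (grad p)‖ ^ 2) ≤
      σ ^ domDim d i / γ * K * (contrast D M *
        cellInt G i T (fun y => ⟪D.A y (gradAt G i p y), gradAt G i p y⟫) +
        supNorm D M * h ^ 2 * cellInt G i T (fun y => normalSq G i y (grad p))) := by
  have hσ := mesh.sigma_pos hh hT
  have hdiam := mesh.le_diam hh hT
  have hdiam0 : 0 < Metric.diam (body T) := lt_of_lt_of_le (by positivity) hdiam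
  have hms : MeasurableSet (body T ∩ G.dom i) := measurableSet_body_inter_dom T
  have hS := supNorm_nonneg D M
  rw [LargeIntersection, le_div_iff₀ (by positivity)] at hL
  -- a set of infinite measure has `Measure.real` equal to `0`, so it is not a large intersection
  have hfin : (μHE[domDim d i] : Measure (Space d)) (body T ∩ G.dom i) ≠ ⊤ := by
    intro htop
    rw [measureReal_def, htop, ENNReal.toReal_top] at hL
    exact absurd hL (not_le.2 (by positivity))
  have hint1 : IntegrableOn (fun y => ⟪D.A y (gradAt G i p y), gradAt G i p y⟫)
      (body T ∩ G.dom i) μHE[domDim d i] :=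
    integrableOn_inner_gradAt D hms inter_subset_right hfin p
  have hint2 : IntegrableOn (fun y => normalSq G i y (grad p)) (body T ∩ G.dom i)
      μHE[domDim d i] := by
    have : IsFiniteMeasure ((μHE[domDim d i] : Measure (Space d)).restrict (body T ∩ G.dom i)) :=
      ⟨by simpa using hfin.lt_top⟩
    refine Integrable.of_bound (((continuousOn_normalSq G i (grad p)).mono
      inter_subset_right).aestronglyMeasurable hms) (‖grad p‖ ^ 2) ?_
    filter_upwards [ae_restrict_mem hms] with y hy
    rw [Real.norm_of_nonneg (normalSq_nonneg _ _ _ _)]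
    exact normalSq_le hy.2 _
  have key := setIntegral_ge_of_const_le_real (c := supNorm D M *
      ‖tangentPart G i x (grad p)‖ ^ 2) hms hfin (fun y hy => ?_)
      (((hint1.const_mul (K * contrast D M))).add (hint2.const_mul (K * (supNorm D M * h ^ 2))))
  swap
  · have h1 := supNorm_mul_norm_sq_le D (body_inter_subset_macroCut hTM hy)
      (tangentPart_gradAt hy.2 p)
    have h2 := mul_le_mul_of_nonneg_left (H y hy) hS
    rw [gradAt] at h1
    simp only [Pi.add_apply, gradAt]
    have h3 := mul_le_mul_of_nonneg_left h1 hK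
    linarith
  have e : ∫ y in body T ∩ G.dom i, ((fun y => K * contrast D M *
      ⟪D.A y (gradAt G i p y), gradAt G i p y⟫) +
      fun y => K * (supNorm D M * h ^ 2) * normalSq G i y (grad p)) y ∂μHE[domDim d i] =
      K * (contrast D M *
        cellInt G i T (fun y => ⟪D.A y (gradAt G i p y), gradAt G i p y⟫) +
        supNorm D M * h ^ 2 * cellInt G i T (fun y => normalSq G i y (grad p))) := by
    rw [integral_add' (hint1.const_mul _) (hint2.const_mul _), integral_const_mul,
      integral_const_mul, cellInt, cellInt]
    ring
  rw [e] at key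
  have h5 : γ * (h / σ) ^ domDim d i ≤
      (μHE[domDim d i] : Measure (Space d)).real (body T ∩ G.dom i) := by
    refine le_trans ?_ hL
    gcongr
  have h6 := (mul_le_mul_of_nonneg_left h5 (mul_nonneg hS (sq_nonneg _))).trans key
  have h7 := mul_le_mul_of_nonneg_left h6 (show 0 ≤ σ ^ domDim d i / γ by positivity)
  refine le_trans (le_of_eq ?_) (h7.trans_eq (by ring))
  rw [div_pow]
  field_simp

end Macro

section MacroBound

variable {d : ℕ} {G : CutDomain d} {i : Fin 3}

/-- The tangential gradient at any point of a cut macro element, weighted by the coefficient and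
scaled by `h ^ dᵢ`, is controlled by the energy and the stabilization of the macro element. -/
theorem exists_pointwise_bound (hd : 0 < d) (G : CutDomain d) (i : Fin 3) {h₀ σ γ c₁ : ℝ} (N : ℕ)
    (hσ : 0 < σ) (hγ : 0 < γ) (hc₁ : 0 < c₁) :
    ∃ C > 0, ∀ h ∈ Ioc 0 h₀, ∀ (mesh : Mesh G h σ) (P : MacroPartition mesh i γ N)
      (D : DiffusionField G i) (τ : Fin 3 → ℝ), ∀ M ∈ P.macros, (∀ k, c₁ * supNorm D M ≤ τ k) →
      ∀ v : Finset (Space d) → (Space d →ᵃ[ℝ] ℝ), ∀ T ∈ M, ∀ x ∈ body T ∩ G.dom i,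
        h ^ domDim d i * (supNorm D M * ‖gradAt G i (v T) x‖ ^ 2) ≤
          C * (contrast D M * gradForm D M v v + stabMacro G i h τ M v v) := by
  obtain ⟨K, hK, HK⟩ := exists_tangentPart_sq_le G i ((N + 1) * σ) h₀
  have hω := unitBallVolume_pos (d - 1)
  set CJ : ℝ := N ^ 2 * (2 * (σ ^ 2) ^ (d - 1) / unitBallVolume (d - 1)) / c₁ with hCJ
  set CT : ℝ := σ ^ domDim d i / γ * K with hCT
  have hCJ0 : 0 ≤ CJ := by positivity
  have hCT0 : 0 < CT := by positivity
  refine ⟨2 * CJ + 2 * CT * (1 + 1 / c₁), by positivity, ?_⟩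
  intro h hh mesh P D τ M hMP hτ v T hTM x hx
  have hh0 : 0 < h := hh.1
  have hMc : M ⊆ mesh.cells := (P.subset_active M hMP).trans (mesh.active_subset i)
  obtain ⟨TM, hTMM, hL, hconn⟩ := P.connected M hMP
  obtain ⟨n, hnN, p, hp0, hpn, hpM, hpk⟩ := hconn T hTM
  have hS := supNorm_nonneg D M
  have hstab := le_stabMacro (G := G) (i := i) hh0 (mul_nonneg hc₁.le hS) hτ M v
  have hJ0 := jumpEnergy_nonneg M v
  have hN0 := normalEnergy_nonneg (G := G) (i := i) M v
  have hg0 := gradForm_self_nonneg D M v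
  have hc0 := contrast_nonneg D (macroCut_nonempty hTMM (P.subset_active M hMP hTMM))
  have hz : 0 ≤ h ^ (1 - domCodim i) := by positivity
  have hJs : supNorm D M * h ^ (1 - domCodim i) * jumpEnergy M v ≤
      1 / c₁ * stabMacro G i h τ M v v := by
    rw [div_mul_eq_mul_div, one_mul, le_div_iff₀ hc₁]
    have : 0 ≤ c₁ * supNorm D M * h ^ 2 * normalEnergy G i M v := by positivity
    linarith
  have hNs : supNorm D M * h ^ 2 * normalEnergy G i M v ≤
      1 / c₁ * stabMacro G i h τ M v v := by
    rw [div_mul_eq_mul_div, one_mul, le_div_iff₀ hc₁]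
    have : 0 ≤ c₁ * supNorm D M * h ^ (1 - domCodim i) * jumpEnergy M v := by positivity
    linarith
  have hs0 : 0 ≤ stabMacro G i h τ M v v := by
    refine le_trans ?_ hstab
    positivity
  -- the gradient jump across one face is at most `β`
  set q : ℝ := (h / σ ^ 2) ^ (d - 1) * unitBallVolume (d - 1) with hq
  have hq0 : 0 < q := by positivity
  set β : ℝ := Real.sqrt (2 * jumpEnergy M v / q) with hβ
  have hβjump : ∀ T ∈ M, ∀ T' ∈ M, FaceNeighbor T T' → ‖grad (v T) - grad (v T')‖ ≤ β := by
    intro T hT T' hT' hn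
    refine Real.le_sqrt_of_sq_le ?_
    rw [le_div_iff₀' hq0]
    exact mesh.grad_jump_sq_le hd hh0 hMc v hT hT' hn
  obtain ⟨hdist, hgrad⟩ := mesh.chain_estimate hd hMc hβjump hpM hpk n le_rfl
  rw [hp0, hpn] at hdist hgrad
  have hnN' : (n : ℝ) ≤ N := by exact_mod_cast hnN
  have hgrad2 : ‖grad (v T) - grad (v TM)‖ ^ 2 ≤ N ^ 2 * (2 * jumpEnergy M v / q) := by
    calc ‖grad (v T) - grad (v TM)‖ ^ 2 ≤ (N * β) ^ 2 := by
          have : 0 ≤ β := Real.sqrt_nonneg _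
          gcongr
          exact hgrad.trans (by gcongr)
      _ = _ := by rw [mul_pow, hβ, Real.sq_sqrt (by positivity)]
  have hδ : h ^ domDim d i * (supNorm D M * ‖tangentPart G i x (grad (v T) - grad (v TM))‖ ^ 2) ≤
      CJ * stabMacro G i h τ M v v := by
    calc h ^ domDim d i * (supNorm D M * ‖tangentPart G i x (grad (v T) - grad (v TM))‖ ^ 2)
        ≤ h ^ domDim d i * (supNorm D M * (N ^ 2 * (2 * jumpEnergy M v / q))) := by
          gcongr
          refine le_trans ?_ hgrad2
          gcongr
          exact norm_tangentPart_le hx.2 _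
      _ = N ^ 2 * (2 * (σ ^ 2) ^ (d - 1) / unitBallVolume (d - 1)) *
          (supNorm D M * h ^ (1 - domCodim i) * jumpEnergy M v) := by
          rw [pow_domDim hd, hq, div_pow]
          field_simp
      _ ≤ N ^ 2 * (2 * (σ ^ 2) ^ (d - 1) / unitBallVolume (d - 1)) *
          (1 / c₁ * stabMacro G i h τ M v v) := by gcongr
      _ = _ := by rw [hCJ]; ring
  have hTMbound := supNorm_mul_tangentPart_sq_le hh0 hγ D hTMM (hMc hTMM) hL hK.le (x := x) (v TM)
    fun y hy => HK h hh x hx.2 y hy.2 (by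
      refine (hdist x hx.1 y hy.1).trans ?_
      rw [← mul_assoc]
      gcongr) _
  have hcell1 : cellInt G i TM (fun y => ⟪D.A y (gradAt G i (v TM) y), gradAt G i (v TM) y⟫) ≤
      gradForm D M v v :=
    Finset.single_le_sum
      (f := fun T => cellInt G i T fun y => ⟪D.A y (gradAt G i (v T) y), gradAt G i (v T) y⟫)
      (fun T _ => cellInt_inner_gradAt_nonneg D T _) hTMM
  have hcell2 : cellInt G i TM (fun y => normalSq G i y (grad (v TM))) ≤ normalEnergy G i M v :=
    Finset.single_le_sum (f := fun T => cellInt G i T fun y => normalSq G i y (grad (v T)))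
      (fun T _ => cellInt_nonneg fun _ _ => normalSq_nonneg _ _ _ _) hTMM
  have hTM2 : h ^ domDim d i * (supNorm D M * ‖tangentPart G i x (grad (v TM))‖ ^ 2) ≤
      CT * (contrast D M * gradForm D M v v + 1 / c₁ * stabMacro G i h τ M v v) := by
    refine hTMbound.trans ?_
    rw [← hCT]
    have h1 : supNorm D M * h ^ 2 * cellInt G i TM (fun y => normalSq G i y (grad (v TM))) ≤
        1 / c₁ * stabMacro G i h τ M v v := le_trans (by gcongr) hNs
    gcongr
  -- compare the gradients of `T` and `TM` at the same point `x`, and only then move `x` into `TM`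
  have hsplit := norm_add_sq_le_two (tangentPart G i x (grad (v T) - grad (v TM)))
    (tangentPart G i x (grad (v TM)))
  rw [← tangentPart_add, sub_add_cancel] at hsplit
  have hfac : 0 ≤ h ^ domDim d i * supNorm D M := by positivity
  have hfin := mul_le_mul_of_nonneg_left hsplit hfac
  have hE0 : 0 ≤ contrast D M * gradForm D M v v := mul_nonneg hc0 hg0
  have e1 : 0 ≤ 2 * CJ * (contrast D M * gradForm D M v v) := by positivity
  have e2 : 0 ≤ 2 * CT * (1 / c₁ * (contrast D M * gradForm D M v v)) := by positivity
  have e3 : 0 ≤ 2 * CT * stabMacro G i h τ M v v := by positivity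
  rw [gradAt]
  linarith

/-- The trace of an interior face on `Ωᵢ` has `(dᵢ - 1)`-dimensional measure of order
`h ^ (dᵢ - 1)`. -/
theorem Mesh.muHE_cutFace_le {h σ cE : ℝ} (mesh : Mesh G h σ) (hd : 0 < d) (hh : 0 < h)
    (hE : i = 0 → mesh.SurfaceCutBound cE) {T T' : Finset (Space d)} (hT : T ∈ mesh.active i)
    (hT' : T' ∈ mesh.active i) (hn : FaceNeighbor T T') :
    (μHE[domDim d i - 1] : Measure (Space d)) (body (face T T') ∩ G.dom i) ≤
      ENNReal.ofReal (((2 * σ) ^ (d - 1) * unitBallVolume (d - 1) + |cE|) *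
        h ^ (domDim d i - 1)) := by
  have hσ := mesh.sigma_pos hh (mesh.active_subset i hT)
  have hω := unitBallVolume_pos (d - 1)
  by_cases hi : i = 0
  · subst hi
    have e : domDim d 0 - 1 = d - 2 := by simp only [domDim, if_true]; omega
    rw [e]
    refine (hE rfl T hT T' hT' hn).trans (ENNReal.ofReal_le_ofReal ?_)
    gcongr
    have := le_abs_self cE
    have : 0 ≤ (2 * σ) ^ (d - 1) * unitBallVolume (d - 1) := by positivity
    linarith
  · have e : domDim d i - 1 = d - 1 := by simp only [domDim, hi, if_false]
    rw [e]
    refine (measure_mono inter_subset_left).trans ((mesh.muHE_face_le hd hh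
      (mesh.active_subset i hT) hn).trans (ENNReal.ofReal_le_ofReal ?_))
    rw [mul_pow, add_mul]
    have : 0 ≤ |cE| * h ^ (d - 1) := by positivity
    linarith

theorem Mesh.body_subset_of_faceNeighbor {h σ : ℝ} (mesh : Mesh G h σ) (hd : 0 < d)
    {T T' : Finset (Space d)} (hT : T ∈ mesh.cells) (hT' : T' ∈ mesh.cells)
    (hn : FaceNeighbor T T') {x : Space d} (hx : x ∈ body T) :
    body T' ⊆ Metric.closedBall x (2 * σ * h) := by
  intro y hy
  obtain ⟨z, hz⟩ : (face T T').Nonempty := Finset.card_pos.1 (by rw [hn.2]; exact hd)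
  have h1 := (dist_le_diam_body T' hy (subset_convexHull ℝ _ (face_subset_right _ _ hz))).trans
    (mesh.quasiuniform T' hT').2
  have h2 := (dist_le_diam_body T (subset_convexHull ℝ _ (face_subset_left _ _ hz)) hx).trans
    (mesh.quasiuniform T hT).2
  rw [Metric.mem_closedBall]
  linarith [dist_triangle y z x]

/-- A macro element has a bounded number of elements, since all of them lie within a distance of
order `h` from the element with a large intersection. -/
theorem MacroPartition.card_le {h σ γ : ℝ} {N : ℕ} {mesh : Mesh G h σ}
    (P : MacroPartition mesh i γ N) (hd : 0 < d) (hh : 0 < h) (hσ : 0 < σ)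
    {M : Finset (Finset (Space d))} (hM : M ∈ P.macros) :
    (M.card : ℝ) ≤ ((N + 1) * σ * σ ^ 2) ^ d := by
  have hMc : M ⊆ mesh.cells := (P.subset_active M hM).trans (mesh.active_subset i)
  obtain ⟨TM, hTMM, -, hconn⟩ := P.connected M hM
  obtain ⟨y, hy⟩ : TM.Nonempty := Finset.card_pos.1 (by rw [mesh.card_eq TM (hMc hTMM)]; omega)
  refine mesh.card_le_of_subset_closedBall hh hMc (x := y) (by positivity) fun T hT x hx => ?_
  obtain ⟨n, hnN, p, hp0, hpn, hpM, hpk⟩ := hconn T hT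
  have h1 := (mesh.chain_estimate hd hMc (v := fun _ => 0) (β := 0) (by simp) hpM hpk n le_rfl).1
  rw [hp0, hpn] at h1
  rw [Metric.mem_closedBall]
  refine (h1 x hx y (subset_convexHull ℝ _ hy)).trans ?_
  rw [mul_assoc]
  gcongr

open scoped Classical in
theorem Mesh.card_neighbors_le {h σ : ℝ} (mesh : Mesh G h σ) (hd : 0 < d) (hh : 0 < h)
    {T : Finset (Space d)} (hT : T ∈ mesh.cells) :
    (((mesh.active i).filter fun T' => FaceNeighbor T T').card : ℝ) ≤ (2 * σ * σ ^ 2) ^ d := by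
  have hσ := mesh.sigma_pos hh hT
  obtain ⟨y, hy⟩ : T.Nonempty := Finset.card_pos.1 (by rw [mesh.card_eq T hT]; omega)
  refine mesh.card_le_of_subset_closedBall hh
    ((Finset.filter_subset _ _).trans (mesh.active_subset i)) (x := y) (by positivity)
    fun T' hT' => ?_
  rw [Finset.mem_filter] at hT'
  exact mesh.body_subset_of_faceNeighbor hd hT (mesh.active_subset i hT'.1) hT'.2
    (subset_convexHull ℝ _ hy)

/-- The inverse inequality on the faces of one macro element. -/
theorem exists_macro_face_bound (hd : 1 < d) (G : CutDomain d) (i : Fin 3)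
    (h₀ σ γ c₁ cE : ℝ) (N : ℕ) (hγ : 0 < γ) (hc₁ : 0 < c₁) :
    ∃ C > 0, ∀ h ∈ Ioc 0 h₀, ∀ (mesh : Mesh G h σ), (i = 0 → mesh.SurfaceCutBound cE) →
      ∀ (P : MacroPartition mesh i γ N) (D : DiffusionField G i) (τ : Fin 3 → ℝ),
      ∀ M ∈ P.macros, (∀ k, c₁ * supNorm D M ≤ τ k) →
      ∀ v : Finset (Space d) → (Space d →ᵃ[ℝ] ℝ),
        h * gradFaceNormSq mesh D M v ≤
          C * (contrast D M * gradForm D M v v + stabMacro G i h τ M v v) := by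
  classical
  have hd0 : 0 < d := by omega
  by_cases hσ : 0 < σ
  swap
  · refine ⟨1, one_pos, fun h hh mesh _ P D τ M hM => absurd ?_ hσ⟩
    obtain ⟨TM, hTM, -⟩ := P.connected M hM
    exact mesh.sigma_pos hh.1 (mesh.active_subset i (P.subset_active M hM hTM))
  obtain ⟨C, hC, H⟩ := exists_pointwise_bound hd0 G i (h₀ := h₀) N hσ hγ hc₁
  have hω := unitBallVolume_pos (d - 1)
  set cF : ℝ := (2 * σ) ^ (d - 1) * unitBallVolume (d - 1) + |cE| with hcF
  have hcF0 : 0 < cF := by positivity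
  refine ⟨((N + 1) * σ * σ ^ 2) ^ d * ((2 * σ * σ ^ 2) ^ d * (C * cF)), by positivity, ?_⟩
  intro h hh mesh hE P D τ M hM hτ v
  have hh0 : 0 < h := hh.1
  have hMa := P.subset_active M hM
  set E : ℝ := contrast D M * gradForm D M v v + stabMacro G i h τ M v v with hEdef
  have hk : 0 < domDim d i := by unfold domDim; split_ifs <;> omega
  have hE0 : 0 ≤ E := by
    obtain ⟨TM, hTM, -⟩ := P.connected M hM
    obtain ⟨x, hx⟩ := (Finset.mem_filter.1 (hMa hTM)).2
    have h1 := H h hh mesh P D τ M hM hτ v TM hTM x hx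
    have h2 : 0 ≤ h ^ domDim d i * (supNorm D M * ‖gradAt G i (v TM) x‖ ^ 2) := by
      have := supNorm_nonneg D M
      positivity
    exact nonneg_of_mul_nonneg_right (h2.trans h1) hC
  have hface : ∀ T ∈ M, ∀ T' ∈ mesh.active i, FaceNeighbor T T' →
      h * cutFaceInt G i (face T T') (fun x => ⟪D.A x (gradAt G i (v T) x), gradAt G i (v T) x⟫) ≤
        C * cF * E := by
    intro T hT T' hT' hn
    have hmu := mesh.muHE_cutFace_le hd0 hh0 hE (hMa hT) hT' hn
    rw [← hcF] at hmu
    have hfin := hmu.trans_lt ENNReal.ofReal_lt_top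
    have hreal : (μHE[domDim d i - 1] : Measure (Space d)).real (body (face T T') ∩ G.dom i) ≤
        cF * h ^ (domDim d i - 1) :=
      ENNReal.toReal_le_of_le_ofReal (by positivity) hmu
    have hb : ∀ x ∈ body (face T T') ∩ G.dom i,
        ‖⟪D.A x (gradAt G i (v T) x), gradAt G i (v T) x⟫‖ ≤ C * E / h ^ domDim d i := by
      intro x hx
      have hxT : x ∈ body T ∩ G.dom i := ⟨body_mono (face_subset_left _ _) hx.1, hx.2⟩
      rw [Real.norm_of_nonneg (D.inner_nonneg hx.2 (tangentPart_gradAt hx.2 _)),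
        le_div_iff₀' (by positivity)]
      refine le_trans ?_ (H h hh mesh P D τ M hM hτ v T hT x hxT)
      gcongr
      exact inner_le_supNorm_mul D (body_inter_subset_macroCut hT hxT) _
    have h1 := (le_abs_self _).trans (norm_setIntegral_le_of_norm_le_const hfin hb)
    calc h * cutFaceInt G i (face T T')
          (fun x => ⟪D.A x (gradAt G i (v T) x), gradAt G i (v T) x⟫)
        ≤ h * (C * E / h ^ domDim d i * (cF * h ^ (domDim d i - 1))) := by
          gcongr
          exact h1.trans (by gcongr)
      _ = _ := by
          have e : h ^ domDim d i = h * h ^ (domDim d i - 1) := by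
            rw [← pow_succ']
            congr 1
            omega
          rw [e]
          field_simp
  have hrow : ∀ T ∈ M, h * ∑ T' ∈ mesh.active i with FaceNeighbor T T',
      cutFaceInt G i (face T T') (fun x => ⟪D.A x (gradAt G i (v T) x), gradAt G i (v T) x⟫) ≤
        (2 * σ * σ ^ 2) ^ d * (C * cF * E) := by
    intro T hT
    rw [Finset.mul_sum]
    refine (Finset.sum_le_card_nsmul _ _ (C * cF * E) fun T' hT' => ?_).trans ?_
    · rw [Finset.mem_filter] at hT'
      exact hface T hT T' hT'.1 hT'.2
    · rw [nsmul_eq_mul]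
      gcongr
      exact mesh.card_neighbors_le hd0 hh0 (mesh.active_subset i (hMa hT))
  rw [gradFaceNormSq, Finset.mul_sum]
  refine (Finset.sum_le_card_nsmul _ _ _ hrow).trans ?_
  rw [nsmul_eq_mul]
  have := P.card_le hd0 hh0 hσ hM
  calc (M.card : ℝ) * ((2 * σ * σ ^ 2) ^ d * (C * cF * E))
      ≤ ((N + 1) * σ * σ ^ 2) ^ d * ((2 * σ * σ ^ 2) ^ d * (C * cF * E)) := by gcongr
    _ = _ := by ring

theorem MacroPartition.sum_active {h σ γ : ℝ} {N : ℕ} {mesh : Mesh G h σ}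
    (P : MacroPartition mesh i γ N) (f : Finset (Space d) → ℝ) :
    ∑ T ∈ mesh.active i, f T = ∑ M ∈ P.macros, ∑ T ∈ M, f T := by
  classical
  have hunion : mesh.active i = P.macros.biUnion id := by
    ext T
    simp only [Finset.mem_biUnion, id]
    constructor
    · intro hT
      obtain ⟨M, hM, -⟩ := P.existsUnique T hT
      exact ⟨M, hM⟩
    · rintro ⟨M, hM, hT⟩
      exact P.subset_active M hM hT
  rw [hunion, Finset.sum_biUnion]
  · rfl
  · intro M hM M' hM' hne
    refine Finset.disjoint_left.2 fun T hT hT' => hne ?_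
    exact (P.existsUnique T (P.subset_active M hM hT)).unique ⟨hM, hT⟩ ⟨hM', hT'⟩

end MacroBound

/-! ### Face integrals in the bilinear form and in the energy norm -/

section FaceSumAlgebra

variable {d : ℕ} {S : Finset (Finset (Space d))}
  {f g : Finset (Space d) → Finset (Space d) → ℝ}

theorem faceSum_mono (hfg : ∀ T ∈ S, ∀ T' ∈ S, FaceNeighbor T T' → f T T' ≤ g T T') :
    faceSum S f ≤ faceSum S g := by
  classical
  refine mul_le_mul_of_nonneg_left ?_ (by norm_num)
  refine Finset.sum_le_sum fun T hT => Finset.sum_le_sum fun T' hT' => ?_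
  rw [Finset.mem_filter] at hT'
  exact hfg T hT T' hT'.1 hT'.2

theorem faceSum_add : faceSum S (fun T T' => f T T' + g T T') = faceSum S f + faceSum S g := by
  simp only [faceSum, Finset.sum_add_distrib, mul_add]

theorem faceSum_const_mul (c : ℝ) : faceSum S (fun T T' => c * f T T') = c * faceSum S f := by
  simp only [faceSum, ← Finset.mul_sum]
  ring

theorem faceSum_swap : faceSum S (fun T T' => f T' T) = faceSum S f := by
  classical
  simp only [faceSum, Finset.sum_filter]
  rw [Finset.sum_comm]
  have h : ∀ T T' : Finset (Space d), FaceNeighbor T T' ↔ FaceNeighbor T' T :=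
    fun T T' => ⟨FaceNeighbor.symm, FaceNeighbor.symm⟩
  congr 1
  refine Finset.sum_congr rfl fun T _ => Finset.sum_congr rfl fun T' _ => ?_
  simp only [h T' T]

end FaceSumAlgebra

section FaceIntegrals

theorem integrable_fun_add {α : Type*} [MeasurableSpace α] {μ : Measure α} {f g : α → ℝ}
    (hf : Integrable f μ) (hg : Integrable g μ) : Integrable (fun x => f x + g x) μ :=
  hf.add hg

variable {d : ℕ} {G : CutDomain d} {i : Fin 3} {h σ cE : ℝ} {mesh : Mesh G h σ}
  (D : DiffusionField G i)

/-- The energy of the trace from `T` of the tangential gradient on the face shared by `T` and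
`T'`. -/
noncomputable def traceEnergy (v : Finset (Space d) → (Space d →ᵃ[ℝ] ℝ))
    (T T' : Finset (Space d)) : ℝ :=
  cutFaceInt G i (face T T') fun x => ⟪D.A x (gradAt G i (v T) x), gradAt G i (v T) x⟫

/-- The energy of the jump on the face shared by `T` and `T'`, times the co-normal of `T`. -/
noncomputable def penaltyEnergy (v : Finset (Space d) → (Space d →ᵃ[ℝ] ℝ))
    (T T' : Finset (Space d)) : ℝ :=
  cutFaceInt G i (face T T') fun x =>
    ⟪D.A x (jump v T T' x • conormal G i T T' x), jump v T T' x • conormal G i T T' x⟫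

theorem gradFaceNormSq_active (v : Finset (Space d) → (Space d →ᵃ[ℝ] ℝ)) :
    gradFaceNormSq mesh D (mesh.active i) v = 2 * faceSum (mesh.active i) (traceEnergy D v) := by
  simp only [gradFaceNormSq, faceSum, traceEnergy]
  ring

theorem tangentPart_jump_conormal {x : Space d} (hx : x ∈ G.dom i) (c : ℝ)
    (T T' : Finset (Space d)) :
    tangentPart G i x (c • conormal G i T T' x) = c • conormal G i T T' x := by
  rw [tangentPart_smul, tangentPart_conormal hx]

theorem penaltyEnergy_nonneg (v : Finset (Space d) → (Space d →ᵃ[ℝ] ℝ))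
    (T T' : Finset (Space d)) : 0 ≤ penaltyEnergy D v T T' :=
  setIntegral_nonneg (measurableSet_body_inter_dom _) fun _ hx =>
    D.inner_nonneg hx.2 (tangentPart_jump_conormal hx.2 _ _ _)

theorem integrableOn_penalty {F : Finset (Space d)} {μ : Measure (Space d)}
    (hμ : μ (body F ∩ G.dom i) ≠ ⊤) (v : Finset (Space d) → (Space d →ᵃ[ℝ] ℝ))
    (T T' : Finset (Space d)) :
    IntegrableOn (fun x => ⟪D.A x (jump v T T' x • conormal G i T T' x),
      jump v T T' x • conormal G i T T' x⟫) (body F ∩ G.dom i) μ := by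
  have hms : MeasurableSet (body F ∩ G.dom i) := measurableSet_body_inter_dom F
  have hc : Continuous (jump v T T') :=
    (v T).continuous_of_finiteDimensional.sub (v T').continuous_of_finiteDimensional
  obtain ⟨B, hB⟩ := (isCompact_body F).exists_bound_of_continuousOn hc.continuousOn
  refine integrableOn_inner_diffusion D hms inter_subset_right hμ
    (hc.aestronglyMeasurable.smul
      (aestronglyMeasurable_conormal G i T T' hms inter_subset_right μ)) (R := B) fun x hx => ?_
  rw [norm_smul]
  exact (mul_le_of_le_one_right (norm_nonneg _) (norm_conormal_le _ _ _ _ _)).trans (hB x hx.1)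

variable {κ : ℝ}

/-- Young's inequality for the flux of one element. -/
theorem abs_flux_le {x ξ ν : Space d} {θ J δ : ℝ} (hθ0 : 0 ≤ θ) (hθ1 : θ ≤ 1) (hδ : 0 < δ)
    (hξ : ‖D.A x‖ * ‖ξ‖ ^ 2 ≤ κ * ⟪D.A x ξ, ξ⟫)
    (hν : ‖D.A x‖ * ‖J • ν‖ ^ 2 ≤ κ * ⟪D.A x (J • ν), J • ν⟫) :
    |θ * ⟪ν, D.A x ξ⟫ * J| ≤
      κ / 2 * (δ * ⟪D.A x ξ, ξ⟫ + δ⁻¹ * ⟪D.A x (J • ν), J • ν⟫) := by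
  have e : θ * ⟪ν, D.A x ξ⟫ * J = θ * ⟪J • ν, D.A x ξ⟫ := by
    rw [real_inner_smul_left]; ring
  have h1 : |θ * ⟪ν, D.A x ξ⟫ * J| ≤ ‖D.A x‖ * (‖J • ν‖ * ‖ξ‖) := by
    rw [e, abs_mul, abs_of_nonneg hθ0]
    refine (mul_le_of_le_one_left (abs_nonneg _) hθ1).trans (inner_le_norm_mul_sq _ _ _)
  have h2 : ‖J • ν‖ * ‖ξ‖ ≤ 1 / 2 * (δ * ‖ξ‖ ^ 2 + δ⁻¹ * ‖J • ν‖ ^ 2) := by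
    have h3 : 0 ≤ δ⁻¹ * (‖J • ν‖ - δ * ‖ξ‖) ^ 2 := by positivity
    have h4 : δ⁻¹ * (‖J • ν‖ - δ * ‖ξ‖) ^ 2 =
        δ⁻¹ * ‖J • ν‖ ^ 2 - 2 * (‖J • ν‖ * ‖ξ‖) + δ * ‖ξ‖ ^ 2 := by
      field_simp
      ring
    linarith
  have h5 := mul_le_mul_of_nonneg_left hξ hδ.le
  have h6 := mul_le_mul_of_nonneg_left hν (inv_pos.2 hδ).le
  have h7 := mul_le_mul_of_nonneg_left h2 (norm_nonneg (D.A x))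
  linarith

/-- The consistency term is controlled by the trace energy and the penalty energy. A face is summed
in both enumerations, so the flux of each of its elements can be paired with the co-normal of that
same element. -/
theorem faceSum_avgFlux_le (hd : 0 < d) (hh : 0 < h) (hE : i = 0 → mesh.SurfaceCutBound cE)
    (hκ : ∀ T ∈ mesh.active i, ∀ x ∈ body T ∩ G.dom i, ∀ ξ, tangentPart G i x ξ = ξ →
      ‖D.A x‖ * ‖ξ‖ ^ 2 ≤ κ * ⟪D.A x ξ, ξ⟫)
    {θ : Finset (Space d) → Finset (Space d) → ℝ} (hθ : IsWeight θ)
    (v : Finset (Space d) → (Space d →ᵃ[ℝ] ℝ)) {δ : ℝ} (hδ : 0 < δ) :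
    faceSum (mesh.active i) (fun T T' => cutFaceInt G i (face T T') fun x =>
      avgFlux D θ v T T' x * jump v T T' x) ≤
      κ * (δ * faceSum (mesh.active i) (traceEnergy D v) +
        δ⁻¹ * faceSum (mesh.active i) (penaltyEnergy D v)) := by
  have hstep : faceSum (mesh.active i) (fun T T' => cutFaceInt G i (face T T') fun x =>
      avgFlux D θ v T T' x * jump v T T' x) ≤
      faceSum (mesh.active i) (fun T T' => κ / 2 *
        ((δ * traceEnergy D v T T' + δ⁻¹ * penaltyEnergy D v T T') +
          (δ * traceEnergy D v T' T + δ⁻¹ * penaltyEnergy D v T' T))) := by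
    refine faceSum_mono fun T hT T' hT' hn => ?_
    have hμ := ((mesh.muHE_cutFace_le hd hh hE hT hT' hn).trans_lt ENNReal.ofReal_lt_top).ne
    have hms : MeasurableSet (body (face T T') ∩ G.dom i) := measurableSet_body_inter_dom _
    have hg := integrableOn_inner_gradAt D hms inter_subset_right hμ (v T)
    have hg' := integrableOn_inner_gradAt D hms inter_subset_right hμ (v T')
    have hp := integrableOn_penalty D hμ v T T'
    have hp' := integrableOn_penalty D hμ v T' T
    obtain ⟨hθ0, hθs⟩ := hθ T T' hn
    have hθ0' := (hθ T' T hn.symm).1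
    simp only [traceEnergy, penaltyEnergy, cutFaceInt, face_comm T' T]
    rw [← integral_const_mul, ← integral_const_mul, ← integral_const_mul, ← integral_const_mul,
      ← integral_add (hg.const_mul δ) (hp.const_mul δ⁻¹),
      ← integral_add (hg'.const_mul δ) (hp'.const_mul δ⁻¹),
      ← integral_add (integrable_fun_add (hg.const_mul δ) (hp.const_mul δ⁻¹))
        (integrable_fun_add (hg'.const_mul δ) (hp'.const_mul δ⁻¹)), ← integral_const_mul]
    refine (Real.le_norm_self _).trans (norm_integral_le_of_norm_le
      ((integrable_fun_add (integrable_fun_add (hg.const_mul δ) (hp.const_mul δ⁻¹))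
        (integrable_fun_add (hg'.const_mul δ) (hp'.const_mul δ⁻¹))).const_mul (κ / 2)) ?_)
    filter_upwards [ae_restrict_mem hms] with x hx
    have hxT : x ∈ body T ∩ G.dom i := ⟨body_mono (face_subset_left _ _) hx.1, hx.2⟩
    have hxT' : x ∈ body T' ∩ G.dom i := ⟨body_mono (face_subset_right _ _) hx.1, hx.2⟩
    have h1 := abs_flux_le D (κ := κ) (x := x) (J := jump v T T' x) (ν := conormal G i T T' x)
      hθ0 (by linarith) hδ (hκ T hT x hxT _ (tangentPart_gradAt hx.2 (v T)))
      (hκ T hT x hxT _ (tangentPart_jump_conormal hx.2 _ _ _))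
    have h2 := abs_flux_le D (κ := κ) (x := x) (J := jump v T' T x) (ν := conormal G i T' T x)
      hθ0' (by linarith) hδ (hκ T' hT' x hxT' _ (tangentPart_gradAt hx.2 (v T')))
      (hκ T' hT' x hxT' _ (tangentPart_jump_conormal hx.2 _ _ _))
    have e : avgFlux D θ v T T' x * jump v T T' x =
        θ T T' * ⟪conormal G i T T' x, D.A x (gradAt G i (v T) x)⟫ * jump v T T' x +
        θ T' T * ⟪conormal G i T' T x, D.A x (gradAt G i (v T') x)⟫ * jump v T' T x := by
      simp only [avgFlux, jump]; ring
    rw [Real.norm_eq_abs, e]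
    refine (abs_add_le _ _).trans ?_
    linarith
  refine hstep.trans_eq ?_
  rw [faceSum_const_mul, faceSum_add,
    faceSum_swap (f := fun T T' => δ * traceEnergy D v T T' + δ⁻¹ * penaltyEnergy D v T T'),
    faceSum_add, faceSum_const_mul, faceSum_const_mul]
  ring

theorem faceSum_avgGrad_le (hd : 0 < d) (hh : 0 < h) (hE : i = 0 → mesh.SurfaceCutBound cE)
    (hκ : ∀ T ∈ mesh.active i, ∀ x ∈ body T ∩ G.dom i, ∀ ξ, tangentPart G i x ξ = ξ →
      ‖D.A x‖ * ‖ξ‖ ^ 2 ≤ κ * ⟪D.A x ξ, ξ⟫)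
    {θ : Finset (Space d) → Finset (Space d) → ℝ} (hθ : IsWeight θ)
    (v : Finset (Space d) → (Space d →ᵃ[ℝ] ℝ)) :
    faceSum (mesh.active i) (fun T T' => cutFaceInt G i (face T T') fun x =>
      ⟪D.A x (avgGrad G i θ v T T' x), avgGrad G i θ v T T' x⟫) ≤
      2 * κ * faceSum (mesh.active i) (traceEnergy D v) := by
  have hstep : faceSum (mesh.active i) (fun T T' => cutFaceInt G i (face T T') fun x =>
      ⟪D.A x (avgGrad G i θ v T T' x), avgGrad G i θ v T T' x⟫) ≤
      faceSum (mesh.active i) (fun T T' => κ * (traceEnergy D v T T' + traceEnergy D v T' T)) := by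
    refine faceSum_mono fun T hT T' hT' hn => ?_
    have hμ := ((mesh.muHE_cutFace_le hd hh hE hT hT' hn).trans_lt ENNReal.ofReal_lt_top).ne
    have hms : MeasurableSet (body (face T T') ∩ G.dom i) := measurableSet_body_inter_dom _
    have hg := integrableOn_inner_gradAt D hms inter_subset_right hμ (v T)
    have hg' := integrableOn_inner_gradAt D hms inter_subset_right hμ (v T')
    obtain ⟨hθ0, hθs⟩ := hθ T T' hn
    have hθ0' := (hθ T' T hn.symm).1
    simp only [traceEnergy, cutFaceInt, face_comm T' T]
    rw [← integral_add hg hg', ← integral_const_mul]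
    refine (Real.le_norm_self _).trans (norm_integral_le_of_norm_le
      ((integrable_fun_add hg hg').const_mul κ) ?_)
    filter_upwards [ae_restrict_mem hms] with x hx
    have hxT : x ∈ body T ∩ G.dom i := ⟨body_mono (face_subset_left _ _) hx.1, hx.2⟩
    have hxT' : x ∈ body T' ∩ G.dom i := ⟨body_mono (face_subset_right _ _) hx.1, hx.2⟩
    have h1 := hκ T hT x hxT _ (tangentPart_gradAt hx.2 (v T))
    have h2 := hκ T' hT' x hxT' _ (tangentPart_gradAt hx.2 (v T'))
    rw [Real.norm_eq_abs, real_inner_comm]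
    refine (inner_le_norm_mul_sq _ _ _).trans ?_
    have h3 : ‖avgGrad G i θ v T T' x‖ ≤
        θ T T' * ‖gradAt G i (v T) x‖ + θ T' T * ‖gradAt G i (v T') x‖ := by
      refine (norm_add_le _ _).trans_eq ?_
      rw [norm_smul, norm_smul, Real.norm_of_nonneg hθ0, Real.norm_of_nonneg hθ0']
    set a := ‖gradAt G i (v T) x‖
    set b := ‖gradAt G i (v T') x‖
    -- the square of a convex combination is at most the convex combination of the squares
    have h4 : (θ T T' * a + θ T' T * b) ^ 2 ≤ a ^ 2 + b ^ 2 := by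
      have e : θ T' T = 1 - θ T T' := by linarith
      rw [e] at hθ0' ⊢
      nlinarith [mul_nonneg (mul_nonneg hθ0 hθ0') (sq_nonneg (a - b)),
        mul_nonneg hθ0 (sq_nonneg b), mul_nonneg hθ0' (sq_nonneg a)]
    have h5 : ‖avgGrad G i θ v T T' x‖ * ‖avgGrad G i θ v T T' x‖ ≤ a ^ 2 + b ^ 2 := by
      rw [← pow_two]
      exact (pow_le_pow_left₀ (norm_nonneg _) h3 2).trans h4
    have h6 := mul_le_mul_of_nonneg_left h5 (norm_nonneg (D.A x))
    linarith
  refine hstep.trans_eq ?_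
  rw [faceSum_const_mul, faceSum_add, faceSum_swap]
  ring

theorem dgForm_self (θ : Finset (Space d) → Finset (Space d) → ℝ) (τa : ℝ)
    (v : Finset (Space d) → (Space d →ᵃ[ℝ] ℝ)) :
    dgForm mesh D θ τa v v = gradForm D (mesh.active i) v v -
      2 * faceSum (mesh.active i) (fun T T' => cutFaceInt G i (face T T') fun x =>
        avgFlux D θ v T T' x * jump v T T' x) +
      τa * (h⁻¹ * faceSum (mesh.active i) (penaltyEnergy D v)) := by
  have e1 : faceSum (mesh.active i) (fun T T' => cutFaceInt G i (face T T') fun x =>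
      jump v T T' x * avgFlux D θ v T T' x) =
      faceSum (mesh.active i) (fun T T' => cutFaceInt G i (face T T') fun x =>
        avgFlux D θ v T T' x * jump v T T' x) := by
    simp only [mul_comm]
  have e2 : faceSum (mesh.active i) (fun T T' => cutFaceInt G i (face T T') fun x =>
      τa * ⟪conormal G i T T' x, D.A x (conormal G i T T' x)⟫ * h⁻¹ *
        jump v T T' x * jump v T T' x) =
      τa * h⁻¹ * faceSum (mesh.active i) (penaltyEnergy D v) := by
    rw [← faceSum_const_mul]
    congr 1
    ext T T'
    rw [penaltyEnergy, cutFaceInt, cutFaceInt, ← integral_const_mul]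
    congr 1
    ext x
    rw [map_smul, real_inner_smul_left, real_inner_smul_right, real_inner_comm]
    ring
  rw [dgForm, e1, e2]
  ring

end FaceIntegrals

/-! ### The global trace inequality and coercivity -/

section Global

variable {d : ℕ} {G : CutDomain d} {i : Fin 3} {h σ γ : ℝ} {N : ℕ} {mesh : Mesh G h σ}

theorem gradFaceNormSq_eq_sum_macros (P : MacroPartition mesh i γ N) (D : DiffusionField G i)
    (v : Finset (Space d) → (Space d →ᵃ[ℝ] ℝ)) :
    gradFaceNormSq mesh D (mesh.active i) v = ∑ M ∈ P.macros, gradFaceNormSq mesh D M v := by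
  simp only [gradFaceNormSq]
  exact P.sum_active _

theorem gradForm_eq_sum_macros (P : MacroPartition mesh i γ N) (D : DiffusionField G i)
    (v : Finset (Space d) → (Space d →ᵃ[ℝ] ℝ)) :
    gradForm D (mesh.active i) v v = ∑ M ∈ P.macros, gradForm D M v v := by
  simp only [gradForm]
  exact P.sum_active _

theorem stabMacro_self_nonneg (hh : 0 < h) {τ : Fin 3 → ℝ} (hτ : ∀ k, 0 ≤ τ k)
    (M : Finset (Finset (Space d))) (v : Finset (Space d) → (Space d →ᵃ[ℝ] ℝ)) :
    0 ≤ stabMacro G i h τ M v v := by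
  simpa using le_stabMacro (G := G) (i := i) hh le_rfl hτ M v

/-- Bounded contrast makes the size and the tangential coercivity of the coefficient comparable at
each point, whichever macro element the point is seen from. -/
theorem norm_mul_norm_sq_le_of_contrast_le (P : MacroPartition mesh i γ N)
    (D : DiffusionField G i) {κ : ℝ} (hκ : ∀ M ∈ P.macros, contrast D M ≤ κ)
    {T : Finset (Space d)} (hT : T ∈ mesh.active i) {x : Space d} (hx : x ∈ body T ∩ G.dom i)
    {ξ : Space d} (hξ : tangentPart G i x ξ = ξ) : ‖D.A x‖ * ‖ξ‖ ^ 2 ≤ κ * ⟪D.A x ξ, ξ⟫ := by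
  obtain ⟨M, ⟨hM, hTM⟩, -⟩ := P.existsUnique T hT
  have hxM := body_inter_subset_macroCut (G := G) (i := i) hTM hx
  calc ‖D.A x‖ * ‖ξ‖ ^ 2 ≤ supNorm D M * ‖ξ‖ ^ 2 := by
        gcongr
        exact norm_le_supNorm D hxM
    _ ≤ contrast D M * ⟪D.A x ξ, ξ⟫ := supNorm_mul_norm_sq_le D hxM hξ
    _ ≤ κ * ⟪D.A x ξ, ξ⟫ :=
        mul_le_mul_of_nonneg_right (hκ M hM) (D.inner_nonneg hx.2 hξ)

/-- Coercivity follows from the trace inequality `hF` with constant `C`: Young's inequality absorbs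
the consistency terms into half of the energy and a part of the penalty term. -/
theorem coercivity_of_face_bound (hd : 0 < d) (hh : 0 < h) {cE : ℝ}
    (hE : i = 0 → mesh.SurfaceCutBound cE) (P : MacroPartition mesh i γ N)
    (D : DiffusionField G i) {κ : ℝ} (hκ1 : 1 ≤ κ) (hκ : ∀ M ∈ P.macros, contrast D M ≤ κ)
    {τ : Finset (Finset (Space d)) → Fin 3 → ℝ} (hτ : ∀ M ∈ P.macros, ∀ k, 0 ≤ τ M k)
    {θ : Finset (Space d) → Finset (Space d) → ℝ} (hθ : IsWeight θ)
    {v : Finset (Space d) → (Space d →ᵃ[ℝ] ℝ)} {C : ℝ} (hC : 0 < C)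
    (hF : h * gradFaceNormSq mesh D (mesh.active i) v ≤
      C * ∑ M ∈ P.macros, (contrast D M * gradForm D M v v + stabMacro G i h (τ M) M v v))
    {τa : ℝ} (hτa : 4 * κ ^ 3 * C + 1 ≤ τa) :
    (1 / (2 * (1 + κ ^ 2 * C))) * dgNormSq P D τ θ v ≤
      dgForm mesh D θ τa v v + stab P τ v v := by
  have hκ0 : 0 < κ := by linarith
  have hcoef := fun T (hT : T ∈ mesh.active i) x (hx : x ∈ body T ∩ G.dom i) ξ
    (hξ : tangentPart G i x ξ = ξ) => norm_mul_norm_sq_le_of_contrast_le P D hκ hT hx hξ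
  -- with this `δ` the trace inequality bounds twice the first term by half of the
  -- energy and the stabilization
  have hflux := faceSum_avgFlux_le D hd hh hE hcoef hθ v
    (δ := h * (1 / (2 * κ ^ 2 * C))) (by positivity)
  have havg := faceSum_avgGrad_le D hd hh hE hcoef hθ v
  have hp0 : 0 ≤ h⁻¹ * faceSum (mesh.active i) (penaltyEnergy D v) :=
    mul_nonneg (by positivity) (faceSum_nonneg fun _ _ => penaltyEnergy_nonneg D v _ _)
  have hsum : ∑ M ∈ P.macros, (contrast D M * gradForm D M v v + stabMacro G i h (τ M) M v v) ≤
      κ * (gradForm D (mesh.active i) v v + stab P τ v v) := by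
    rw [gradForm_eq_sum_macros P, stab, ← Finset.sum_add_distrib, Finset.mul_sum]
    refine Finset.sum_le_sum fun M hM => ?_
    have h1 := mul_le_mul_of_nonneg_right (hκ M hM) (gradForm_self_nonneg D M v)
    have h2 := mul_le_mul_of_nonneg_right hκ1 
      (stabMacro_self_nonneg (G := G) (i := i) hh (hτ M hM) M v)
    linarith
  rw [gradFaceNormSq_active] at hF
  have hF' := hF.trans (mul_le_mul_of_nonneg_left hsum hC.le)
  rw [dgForm_self, dgNormSq]
  -- `penaltyEnergy` is by definition the integral in the jump term of the norm
  change 1 / (2 * (1 + κ ^ 2 * C)) * (gradForm D (mesh.active i) v v + h * faceSum (mesh.active i)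
    (fun T T' => cutFaceInt G i (face T T') fun x =>
      ⟪D.A x (avgGrad G i θ v T T' x), avgGrad G i θ v T T' x⟫) +
    h⁻¹ * faceSum (mesh.active i) (penaltyEnergy D v) + stab P τ v v) ≤ _
  set Gv := gradForm D (mesh.active i) v v
  set sv := stab P τ v v
  set g := faceSum (mesh.active i) (traceEnergy D v)
  set X := faceSum (mesh.active i) (fun T T' => cutFaceInt G i (face T T') fun x =>
    avgFlux D θ v T T' x * jump v T T' x)
  set Y := faceSum (mesh.active i) (fun T T' => cutFaceInt G i (face T T') fun x =>
    ⟪D.A x (avgGrad G i θ v T T' x), avgGrad G i θ v T T' x⟫)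
  set p := faceSum (mesh.active i) (penaltyEnergy D v)
  have hX : 2 * X ≤ 1 / 2 * (Gv + sv) + 4 * κ ^ 3 * C * (h⁻¹ * p) := by
    have e : κ * (h * (1 / (2 * κ ^ 2 * C)) * g + (h * (1 / (2 * κ ^ 2 * C)))⁻¹ * p) =
        1 / (4 * κ * C) * (h * (2 * g)) + 2 * κ ^ 3 * C * (h⁻¹ * p) := by
      field_simp
      ring
    have h1 := mul_le_mul_of_nonneg_left hF' (show 0 ≤ 1 / (4 * κ * C) by positivity)
    have e2 : 1 / (4 * κ * C) * (C * (κ * (Gv + sv))) = 1 / 4 * (Gv + sv) := by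
      field_simp
    rw [e2] at h1
    rw [e] at hflux
    linarith
  have hY : h * Y ≤ κ ^ 2 * C * (Gv + sv) := by
    have h1 := mul_le_mul_of_nonneg_left havg hh.le
    have h2 := mul_le_mul_of_nonneg_left hF' hκ0.le
    linarith
  have hpτ := mul_le_mul_of_nonneg_right hτa hp0
  have hKC : 0 ≤ κ ^ 2 * C * (h⁻¹ * p) := by positivity
  rw [div_mul_eq_mul_div, one_mul, div_le_iff₀ (by positivity)]
  have hlow : 1 / 2 * (Gv + sv) + h⁻¹ * p ≤ Gv - 2 * X + τa * (h⁻¹ * p) + sv := by linarith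
  refine le_trans ?_ (mul_le_mul_of_nonneg_right hlow (by positivity))
  linarith

end Global

end CutFEM

open CutFEM
theorem mainTheorem6 {d : ℕ} (hd : d = 2 ∨ d = 3) (G : CutDomain d) (i : Fin 3)
    (h₀ σ γ c₁ c₂ cE : ℝ) (N : ℕ) (hγ : 0 < γ) (hc₁ : 0 < c₁) :
    (∃ C > 0, ∀ h ∈ Set.Ioc 0 h₀, ∀ (mesh : Mesh G h σ), (i = 0 → mesh.SurfaceCutBound cE) →
      ∀ (P : MacroPartition mesh i γ N) (D : DiffusionField G i)
        (τ : Finset (Finset (Space d)) → Fin 3 → ℝ), IsStabParam P D c₁ c₂ τ →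
      ∀ v ∈ mesh.feSpace i,
        (∀ M ∈ P.macros, h * gradFaceNormSq mesh D M v ≤
          C * (contrast D M * gradForm D M v v + stabMacro G i h (τ M) M v v)) ∧
        h * gradFaceNormSq mesh D (mesh.active i) v ≤
          C * ∑ M ∈ P.macros,
            (contrast D M * gradForm D M v v + stabMacro G i h (τ M) M v v)) ∧
    (∀ cA : ℝ, ∃ τ₀ > 0, ∃ c > 0, ∀ h ∈ Set.Ioc 0 h₀, ∀ (mesh : Mesh G h σ),
      (i = 0 → mesh.SurfaceCutBound cE) →
      ∀ (P : MacroPartition mesh i γ N) (D : DiffusionField G i),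
      (∀ M ∈ P.macros, contrast D M ≤ cA) →
      ∀ (τ : Finset (Finset (Space d)) → Fin 3 → ℝ), IsStabParam P D c₁ c₂ τ →
      ∀ θ : Finset (Space d) → Finset (Space d) → ℝ, IsWeight θ →
      ∀ τa ≥ τ₀, ∀ v ∈ mesh.feSpace i,
        c * dgNormSq P D τ θ v ≤ dgForm mesh D θ τa v v + stab P τ v v) := by
  obtain ⟨C, hC, H⟩ := exists_macro_face_bound (by omega) G i h₀ σ γ c₁ cE N hγ hc₁
  have Hsum : ∀ h ∈ Set.Ioc 0 h₀, ∀ (mesh : Mesh G h σ), (i = 0 → mesh.SurfaceCutBound cE) →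
      ∀ (P : MacroPartition mesh i γ N) (D : DiffusionField G i)
        (τ : Finset (Finset (Space d)) → Fin 3 → ℝ), IsStabParam P D c₁ c₂ τ →
      ∀ v, h * gradFaceNormSq mesh D (mesh.active i) v ≤
          C * ∑ M ∈ P.macros,
            (contrast D M * gradForm D M v v + stabMacro G i h (τ M) M v v) := by
    intro h hh mesh hE P D τ hτ v
    rw [gradFaceNormSq_eq_sum_macros P, Finset.mul_sum, Finset.mul_sum]
    exact Finset.sum_le_sum fun M hM => H h hh mesh hE P D (τ M) M hM (fun k => (hτ M hM k).1) v
  refine ⟨⟨C, hC, fun h hh mesh hE P D τ hτ v _ =>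
    ⟨fun M hM => H h hh mesh hE P D (τ M) M hM (fun k => (hτ M hM k).1) v,
      Hsum h hh mesh hE P D τ hτ v⟩⟩, fun cA => ?_⟩
  have hκ0 : 0 < max cA 1 := lt_max_of_lt_right one_pos
  refine ⟨4 * max cA 1 ^ 3 * C + 1, by positivity, 1 / (2 * (1 + max cA 1 ^ 2 * C)),
    by positivity, fun h hh mesh hE P D hcA τ hτ θ hθ τa hτa v _ => ?_⟩
  exact coercivity_of_face_bound (by omega) hh.1 hE P D (le_max_right _ _)
    (fun M hM => (hcA M hM).trans (le_max_left _ _))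
    (fun M hM k => (mul_nonneg hc₁.le (supNorm_nonneg D M)).trans (hτ M hM k).1)
    hθ hC (Hsum h hh mesh hE P D τ hτ v) hτa
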